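/- Let $p$ be a prime, $q$ a power of $p$, $F=\mathbb F_q((t))$ with the $t$-adic topology, and $F^-=\mathbb F_q[t^{-1}]\subset F$. Let $e>2$ be a power of $p$ and $$G_2=\left\{\begin{pmatrix}1&y^e&z\\0&1&y\\0&0&1\end{pmatrix} : y,z\in F\right\}\subset GL(3,F).$$ Let $\Gamma$ be an arithmetic lattice in $G_2$, that is, a subgroup of $G_2$ commensurable with $GL(3,F^-)\cap G_2$ (such a subgroup is automatically discrete and cocompact in $G_2$). Let $\lambda$ be a virtual automorphism of $\Gamma$, i.e. an isomorphism $\lambda:\Gamma_1\to\Gamma_2$ between finite-index subgroups of $\Gamma$. For a continuous field automorphism $\tau$ of $F$ and $a\in F\setminus\{0\}$, let $\phi_{\tau,a}$ be the automorphism of $G_2$ that takes the matrix with parameters $(y,z)$ to the matrix with parameters $(a\,\tau(y),\,a^{e+1}\tau(z))$. Call $\phi_{\tau,a}$ standard if 1. there are $\sigma\in\mathrm{Gal}(\mathbb F_q/\mathbb F_p)$, $\alpha\in\mathbb F_q\setminus\{0\}$ and $\beta\in\mathbb F_q$ such that $\tau(f(t^{-1}))=\sigma(f(\alpha t^{-1}+\beta))$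 for all $f(t^{-1})\in F$, where $\sigma$ acts on the coefficients of Laurent series in $t$; and 2. there is a nonzero $b\in F^-$ with $ab\in F^-$. Then there exist a standard automorphism $\phi_{\tau,a}$ of $G_2$, a finite-index subgroup $\Gamma'$ of $\Gamma$ contained in $\Gamma_1$, and a homomorphism $\zeta:\Gamma'\to Z(\Gamma)$ such that $$\lambda(\gamma)=\phi_{\tau,a}(\gamma)\,\zeta(\gamma)\qquad\text{for all }\gamma\in\Gamma'.$$ -/

import Mathlib

/-- A virtual isomorphism between (discrete) groups: an isomorphism from a finite-index subgroup
of the first group onto a finite-index subgroup of the second. In a discrete group every subgroup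
is open, so no openness condition is needed. -/
structure VirtualIso (G₁ G₂ : Type*) [Group G₁] [Group G₂] where
  source : Subgroup G₁
  target : Subgroup G₂
  source_finiteIndex : source.FiniteIndex
  target_finiteIndex : target.FiniteIndex
  toMulEquiv : source ≃* target

/-- A virtual automorphism of a (discrete) group. -/
abbrev VirtualAut (G : Type*) [Group G] := VirtualIso G G

namespace UnipotentG2

noncomputable section

/-- The element `t⁻¹` of `k((t))`. -/
def tInv (k : Type*) [Field k] : LaurentSeries k := HahnSeries.single (-1 : ℤ) (1 : k)

/-- `F⁻ = k[t⁻¹]`, the `k`-subalgebra of `F = k((t))` generated by `t⁻¹`. -/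
def Fminus (k : Type*) [Field k] : Subalgebra k (LaurentSeries k) :=
  Algebra.adjoin k {tInv k}

/-- The subgroup `GL(m, F⁻)` of `GL(m, F)`: invertible matrices over `F⁻`. -/
def GLminus (k : Type*) [Field k] (m : ℕ) : Subgroup (GL (Fin m) (LaurentSeries k)) :=
  (Matrix.GeneralLinearGroup.map (n := Fin m) (Fminus k).val.toRingHom).range

/-- A subgroup `Γ` of a matrix group `G ≤ GL(m, F)` is arithmetic if it is commensurable with
`GL(m, F⁻) ∩ G`. Over a finite field `k` the latter group is discrete, hence so is every
arithmetic subgroup; for the group `G₂` below every arithmetic subgroup is moreover cocompact,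
so that the arithmetic lattices in `G₂` are exactly its arithmetic subgroups. -/
def IsArithmetic {k : Type*} [Field k] {m : ℕ} (G : Subgroup (GL (Fin m) (LaurentSeries k)))
    (Γ : Subgroup G) : Prop :=
  Subgroup.Commensurable Γ ((GLminus k m).subgroupOf G)

theorem charP_laurent (p : ℕ) [Fact p.Prime] (k : Type*) [Field k] [Algebra (ZMod p) k] :
    CharP (LaurentSeries k) p := by
  have : CharP k p := charP_of_injective_algebraMap (algebraMap (ZMod p) k).injective p
  exact charP_of_injective_algebraMap (algebraMap k (LaurentSeries k)).injective p

/-- The matrix with rows `(1, y ^ e, z)`, `(0, 1, y)`, `(0, 0, 1)`. -/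
def mat {R : Type*} [CommRing R] (e : ℕ) (y z : R) : Matrix (Fin 3) (Fin 3) R :=
  !![1, y ^ e, z; 0, 1, y; 0, 0, 1]

theorem mat_mul {R : Type*} [CommRing R] {p : ℕ} [Fact p.Prime] [CharP R p] (r : ℕ)
    (y z y' z' : R) :
    mat (p ^ r) y z * mat (p ^ r) y' z' =
      mat (p ^ r) (y + y') (z + z' + y ^ p ^ r * y') := by
  ext i j
  fin_cases i <;> fin_cases j <;>
    simp [mat, Matrix.mul_apply, Fin.sum_univ_three, add_pow_char_pow] <;> ring

theorem mat_zero {R : Type*} [CommRing R] {e : ℕ} (he : e ≠ 0) : mat e (0 : R) 0 = 1 := by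
  ext i j
  fin_cases i <;> fin_cases j <;> simp [mat, he]

variable (p : ℕ) [Fact p.Prime] (r : ℕ) (k : Type*) [Field k] [Algebra (ZMod p) k]

theorem pow_ne : p ^ r ≠ 0 := pow_ne_zero _ (Fact.out : p.Prime).ne_zero

theorem mat_mul_inv (y z : LaurentSeries k) :
    mat (p ^ r) y z * mat (p ^ r) (-y) (-z + y ^ p ^ r * y) = 1 := by
  have := charP_laurent p k
  rw [mat_mul, ← mat_zero (pow_ne p r)]
  congr 1 <;> ring

/-- The matrix `mat (p ^ r) y z` as an element of `GL(3, k((t)))`. -/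
def matUnit (y z : LaurentSeries k) : GL (Fin 3) (LaurentSeries k) :=
  ⟨mat (p ^ r) y z, mat (p ^ r) (-y) (-z + y ^ p ^ r * y), mat_mul_inv p r k y z,
    mul_eq_one_comm.mp (mat_mul_inv p r k y z)⟩

/-- The group `G₂` of matrices with rows `(1, y ^ e, z)`, `(0, 1, y)`, `(0, 0, 1)`,
where `e = p ^ r` and `y, z ∈ k((t))`. -/
def G2 : Subgroup (GL (Fin 3) (LaurentSeries k)) where
  carrier := {g | ∃ y z : LaurentSeries k,
    (g : Matrix (Fin 3) (Fin 3) (LaurentSeries k)) = mat (p ^ r) y z}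
  mul_mem' := by
    have := charP_laurent p k
    rintro g g' ⟨y, z, h⟩ ⟨y', z', h'⟩
    refine ⟨y + y', z + z' + y ^ p ^ r * y', ?_⟩
    rw [Units.val_mul, h, h']
    exact mat_mul r y z y' z'
  one_mem' := ⟨0, 0, (mat_zero (pow_ne p r)).symm⟩
  inv_mem' := by
    rintro g ⟨y, z, h⟩
    refine ⟨-y, -z + y ^ p ^ r * y, ?_⟩
    obtain rfl : g = matUnit p r k y z := Units.ext h
    rfl

variable {p r k}

/-- The element of `G₂` with coordinates `y` and `z`. -/
def mk (y z : LaurentSeries k) : G2 p r k :=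
  ⟨matUnit p r k y z, y, z, rfl⟩

/-- The coordinate `y` of an element of `G₂`. -/
def ycoord (g : G2 p r k) : LaurentSeries k :=
  (g.1 : Matrix (Fin 3) (Fin 3) (LaurentSeries k)) 1 2

/-- The coordinate `z` of an element of `G₂`. -/
def zcoord (g : G2 p r k) : LaurentSeries k :=
  (g.1 : Matrix (Fin 3) (Fin 3) (LaurentSeries k)) 0 2

@[simp] theorem ycoord_mk (y z : LaurentSeries k) : ycoord (mk y z : G2 p r k) = y := by
  simp [mk, ycoord, matUnit, mat]

@[simp] theorem zcoord_mk (y z : LaurentSeries k) : zcoord (mk y z : G2 p r k) = z := by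
  simp [mk, zcoord, matUnit, mat]

theorem ext' {g h : G2 p r k} (hy : (ycoord g) = (ycoord h)) (hz : (zcoord g) = (zcoord h)) : g = h := by
  obtain ⟨g, y, z, hg⟩ := g
  obtain ⟨h, y', z', hh⟩ := h
  simp [ycoord, hg, hh, mat] at hy
  simp [zcoord, hg, hh, mat] at hz
  subst hy hz
  exact Subtype.ext (Units.ext (hg.trans hh.symm))

theorem mk_coords (g : G2 p r k) : mk (ycoord g) (zcoord g) = g := ext' (by simp) (by simp)

theorem mk_mul_mk (y z y' z' : LaurentSeries k) :
    (mk y z * mk y' z' : G2 p r k) =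
      mk (y + y') (z + z' + y ^ p ^ r * y') := by
  have := charP_laurent p k
  exact Subtype.ext (Units.ext (mat_mul r y z y' z'))

/-- The automorphism `φ_{τ,a}` of `G₂`: it takes the matrix with coordinates `y, z` to the one
with coordinates `a τ(y)`, `a ^ (e + 1) τ(z)`, where `e = p ^ r`. -/
def phi (τ : LaurentSeries k ≃+* LaurentSeries k) (a : LaurentSeries k) (ha : a ≠ 0) :
    G2 p r k ≃* G2 p r k where
  toFun g := mk (a * τ (ycoord g)) (a ^ (p ^ r + 1) * τ (zcoord g))
  invFun g := mk (τ.symm (a⁻¹ * (ycoord g))) (τ.symm ((a ^ (p ^ r + 1))⁻¹ * (zcoord g)))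
  left_inv g := by
    apply ext' <;> simp [ha]
  right_inv g := by
    apply ext' <;> simp only [ycoord_mk, zcoord_mk, RingEquiv.apply_symm_apply]
    · exact mul_inv_cancel_left₀ ha _
    · exact mul_inv_cancel_left₀ (pow_ne_zero _ ha) _
  map_mul' g h := by
    rw [← mk_coords g, ← mk_coords h, mk_mul_mk]
    simp only [ycoord_mk, zcoord_mk]
    rw [mk_mul_mk]
    simp only [map_add, map_mul, map_pow]
    congr 1 <;> ring

/-- `g` is the Laurent series `f(α t⁻¹ + β)`, obtained from `f = ∑ cₙ tⁿ` by substituting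
`α t⁻¹ + β` for `t⁻¹`, that is, `g = ∑ cₙ (α t⁻¹ + β)⁻ⁿ` in the `t`-adic topology. -/
def IsAffineSubst (α β : k) (f g : LaurentSeries k) : Prop :=
  HasSum (fun n : ℤ => HahnSeries.C (f.coeff n) *
    (HahnSeries.C α * tInv k + HahnSeries.C β) ^ (-n)) g

/-- `τ` is a continuous automorphism of the field `k((t))` of the form
`τ(f(t⁻¹)) = σ(f(α t⁻¹ + β))`, where `σ ∈ Gal(k/𝔽_p)` acts on the coefficients, `α ≠ 0`. -/
def IsAffineTwist (p : ℕ) [Fact p.Prime] [Algebra (ZMod p) k]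
    (τ : LaurentSeries k ≃+* LaurentSeries k) : Prop :=
  Continuous τ ∧ ∃ (σ : k ≃ₐ[ZMod p] k) (α β : k), α ≠ 0 ∧
    ∀ f : LaurentSeries k, ∃ g : LaurentSeries k,
      IsAffineSubst α β f g ∧ τ f = HahnSeries.map g σ

/-- The condition for `φ_{τ,a}` to be standard. -/
def IsStandard (p : ℕ) [Fact p.Prime] [Algebra (ZMod p) k]
    (τ : LaurentSeries k ≃+* LaurentSeries k) (a : LaurentSeries k) : Prop :=
  IsAffineTwist p τ ∧ ∃ b ∈ Fminus k, b ≠ 0 ∧ a * b ∈ Fminus k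

end

end UnipotentG2

/-! Elements with y = 0 are central, so only y has to be controlled. It ranges over k[t⁻¹] up to
finite index. The commutator of elements with coordinates u, v is central with z = [u, v] = u^e v -
u v^e. Hence λ induces an additive correspondence u ↦ u' between finite-index subgroups of k[X],
with X standing for t⁻¹, compatible with a correspondence [u, v] ↦ [u', v'].

This structure detects the lines of K = k(X) over K^e. If u₁/u is an e-th power in K, then [u, k[X]]
+ [u₁, k[X]] has finite index, apart from a degenerate case (`finiteIndex_bracketSumGraph_fst`).
Otherwise its index is infinite: essentially only pairs of polynomials of degree about N reach
degree below eN, too few since e > 2 (`not_finiteIndex_range_bracketSum`). So λ preserves lines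
(`PowRelated.map`).

As in the fundamental theorem of projective geometry, there is a ring homomorphism T with (c^e u)' =
T(c)^e u' (`exists_isMultiplier`, `multiplierHom`). Finite index bounds the denominators, so T maps
k[X] to itself (`multiplierHom_mem_range`), and λ⁻¹ supplies its inverse (`twist_swap_twist`). A
bracket identity improves this to (d u)' = T(d) u' (`eq_twist_mul`), so a = u'/T(u) does not depend
on u (`mul_twist_eq`).

An automorphism T of k[X] is affine up to a field automorphism and extends to a continuous τ on
k((t)) (`exists_isAffineTwist`). Then φ_{τ,a} and λ agree on y, and their quotient is the central
homomorphism ζ. -/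

section

open Polynomial

namespace FrobeniusBracket

/-! ### Finite-index additive subgroups and exchange of coordinates -/

section Index

instance finiteIndex_comap {G G' : Type*} [AddGroup G] [AddGroup G'] (f : G →+ G')
    (A : AddSubgroup G') [A.FiniteIndex] : (A.comap f).FiniteIndex := by
  rw [AddSubgroup.finiteIndex_iff, ← AddSubgroup.relIndex_top_right, ← AddSubgroup.comap_top f]
  refine AddSubgroup.relIndex_comap_ne_zero f ?_
  rw [AddSubgroup.relIndex_top_right]
  exact AddSubgroup.FiniteIndex.index_ne_zero

theorem relIndex_map_ne_zero {G G' : Type*} [AddGroup G] [AddGroup G'] (f : G →+ G')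
    {A B : AddSubgroup G} (h : A.relIndex B ≠ 0) : (A.map f).relIndex (B.map f) ≠ 0 := by
  rw [← AddSubgroup.relIndex_comap]
  exact fun h0 => h (AddSubgroup.relIndex_eq_zero_of_le_left (AddSubgroup.le_comap_map f A) h0)

/-- The image of a subgroup under the exchange of coordinates. -/
def swapSubgroup {G : Type*} [AddGroup G] (H : AddSubgroup (G × G)) : AddSubgroup (G × G) where
  carrier := {x | (x.2, x.1) ∈ H}
  add_mem' h h' := H.add_mem h h'
  zero_mem' := H.zero_mem
  neg_mem' h := H.neg_mem h

theorem mem_swapSubgroup {G : Type*} [AddGroup G] {H : AddSubgroup (G × G)} {a b : G} :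
    (a, b) ∈ swapSubgroup H ↔ (b, a) ∈ H := Iff.rfl

theorem map_fst_swapSubgroup {G : Type*} [AddGroup G] (H : AddSubgroup (G × G)) :
    (swapSubgroup H).map (AddMonoidHom.fst _ _) = H.map (AddMonoidHom.snd _ _) := by
  ext x
  constructor
  · rintro ⟨⟨a, b⟩, h, rfl⟩; exact ⟨(b, a), h, rfl⟩
  · rintro ⟨⟨a, b⟩, h, rfl⟩; exact ⟨(b, a), h, rfl⟩

theorem map_snd_swapSubgroup {G : Type*} [AddGroup G] (H : AddSubgroup (G × G)) :
    (swapSubgroup H).map (AddMonoidHom.snd _ _) = H.map (AddMonoidHom.fst _ _) := by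
  ext x
  constructor
  · rintro ⟨⟨a, b⟩, h, rfl⟩; exact ⟨(b, a), h, rfl⟩
  · rintro ⟨⟨a, b⟩, h, rfl⟩; exact ⟨(b, a), h, rfl⟩

end Index

/-! ### Finite-index subgroups of k[X] -/

section Polynomials

variable {k : Type*} [Field k]

theorem finite_degreeLT [Finite k] (n : ℕ) : Finite (degreeLT k n) :=
  Finite.of_equiv _ (degreeLTEquiv k n).symm.toEquiv

theorem natCard_degreeLT (n : ℕ) : Nat.card (degreeLT k n) = Nat.card k ^ n := by
  rw [Nat.card_congr (degreeLTEquiv k n).toEquiv, Nat.card_fun, Nat.card_fin]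

theorem mem_degreeLT_of_natDegree_lt {n : ℕ} {f : k[X]} (h : f.natDegree < n) :
    f ∈ degreeLT k n :=
  mem_degreeLT.2 (lt_of_le_of_lt degree_le_natDegree (by exact_mod_cast h))

/-- A finite-index subgroup of `k[X]` contains polynomials of arbitrarily large degree. -/
theorem exists_mem_natDegree_gt [Finite k] (A : AddSubgroup k[X]) [A.FiniteIndex] (n : ℕ) :
    ∃ a ∈ A, n < a.natDegree := by
  by_contra! h
  have hle : A ≤ (degreeLT k (n + 1)).toAddSubgroup := fun a ha =>
    mem_degreeLT_of_natDegree_lt (Nat.lt_succ_of_le (h a ha))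
  have := finite_degreeLT (k := k) (n + 1)
  have hfin : Finite A := Finite.of_injective (fun a : A => (⟨a, hle a.2⟩ : degreeLT k (n + 1)))
    fun a b hab => Subtype.ext (congrArg (fun x : degreeLT k (n + 1) => (x : k[X])) hab)
  have : Finite k[X] := AddSubgroup.finite_iff_finite_and_finiteIndex (H := A) |>.2
    ⟨hfin, inferInstance⟩
  exact not_finite k[X]

theorem exists_mem_ne_zero [Finite k] (A : AddSubgroup k[X]) [A.FiniteIndex] :
    ∃ a ∈ A, a ≠ 0 := by
  obtain ⟨a, ha, h⟩ := exists_mem_natDegree_gt A 0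
  exact ⟨a, ha, by rintro rfl; simp at h⟩

/-- The multiples of a nonzero polynomial by the elements of a finite-index subgroup form a
finite-index subgroup. -/
theorem finiteIndex_map_mulLeft [Finite k] (W : AddSubgroup k[X]) [W.FiniteIndex] {N : k[X]}
    (hN : N ≠ 0) : (W.map (AddMonoidHom.mulLeft N)).FiniteIndex := by
  rw [AddSubgroup.finiteIndex_iff, AddSubgroup.index_map_of_injective _
    (fun a b h => mul_left_cancel₀ hN h)]
  refine mul_ne_zero AddSubgroup.FiniteIndex.index_ne_zero ?_
  rw [← AddSubgroup.finiteIndex_iff, AddSubgroup.finiteIndex_iff_finite_quotient]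
  have := finite_degreeLT (k := k) N.natDegree
  -- Remainders modulo N, made monic for the division, represent all cosets.
  refine Finite.of_surjective
    (fun x : degreeLT k N.natDegree => (QuotientAddGroup.mk (x : k[X]) :
      k[X] ⧸ (AddMonoidHom.mulLeft N).range)) ?_
  rintro ⟨f⟩
  have hu : IsUnit (C N.leadingCoeff⁻¹) := by
    simpa using hN
  have hmonic := monic_mul_leadingCoeff_inv hN
  refine ⟨⟨f %ₘ (N * C N.leadingCoeff⁻¹), ?_⟩, ?_⟩
  · rw [mem_degreeLT]
    refine (degree_modByMonic_lt _ hmonic).trans_le ?_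
    rw [degree_mul_leadingCoeff_inv _ hN]
    exact degree_le_natDegree
  · refine (QuotientAddGroup.eq).2 ⟨C N.leadingCoeff⁻¹ * (f /ₘ (N * C N.leadingCoeff⁻¹)), ?_⟩
    have := modByMonic_add_div f (N * C N.leadingCoeff⁻¹)
    simp only [AddMonoidHom.coe_mulLeft]
    linear_combination this

theorem coeff_divX_iterate (i n : ℕ) (u : k[X]) : (divX^[i] u).coeff n = u.coeff (n + i) := by
  induction i generalizing u with
  | zero => simp
  | succ i ih => rw [Function.iterate_succ_apply, ih, coeff_divX, add_assoc]

end Polynomials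

/-! ### Images of the bracket and coordinates over e-th powers -/

section Coordinates

variable {k : Type*} [Field k] (p : ℕ) [Fact p.Prime] [CharP k p] (r : ℕ)

/-- The bracket `u ^ e v - u v ^ e`, where `e = p ^ r`. -/
def bracket {R : Type*} [CommRing R] (e : ℕ) (u v : R) : R := u ^ e * v - u * v ^ e

/-- The map `v ↦ [u, v]`. -/
noncomputable def bracketHom (u : k[X]) : k[X] →+ k[X] :=
  AddMonoidHom.mulLeft (u ^ p ^ r) -
    (AddMonoidHom.mulLeft u).comp (iterateFrobenius k[X] p r : k[X] →+ k[X])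

theorem bracketHom_apply (u v : k[X]) : bracketHom p r u v = bracket (p ^ r) u v := by
  simp [bracketHom, bracket, iterateFrobenius_def]

/-- The map `(v, w) ↦ [u, v] + [u₁, w]`. -/
noncomputable def bracketSum (u u₁ : k[X]) : k[X] × k[X] →+ k[X] :=
  (bracketHom p r u).coprod (bracketHom p r u₁)

theorem bracketSum_apply (u u₁ : k[X]) (x : k[X] × k[X]) : bracketSum p r u u₁ x =
    bracket (p ^ r) u x.1 + bracket (p ^ r) u₁ x.2 := by
  simp [bracketSum, bracketHom_apply]

variable [Finite k]

/-- The coordinates of `u` in the basis `1, X, …, X ^ (e - 1)` of `k[X]` over `k[X] ^ e`, as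
`e`-th roots. -/
noncomputable def coord (i : ℕ) (u : k[X]) : k[X] :=
  ((divX^[i] u).contract (p ^ r)).map (iterateFrobeniusEquiv k p r).symm.toRingHom

theorem coeff_coord (i n : ℕ) (u : k[X]) : (coord p r i u).coeff n =
    (iterateFrobeniusEquiv k p r).symm (u.coeff (n * p ^ r + i)) := by
  simp [coord, coeff_contract (pow_ne_zero r (Fact.out : p.Prime).ne_zero), coeff_divX_iterate]

theorem coord_add (i : ℕ) (u v : k[X]) :
    coord p r i (u + v) = coord p r i u + coord p r i v := by
  ext n; simp [coeff_coord]

theorem coord_ext {u v : k[X]} (h : ∀ i < p ^ r, coord p r i u = coord p r i v) : u = v := by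
  ext n
  have := congrArg (fun f => coeff f (n / p ^ r))
    (h (n % p ^ r) (Nat.mod_lt _ (pow_pos (Fact.out : p.Prime).pos r)))
  simpa [coeff_coord, Nat.div_add_mod'] using this

/-- Taking e-th roots of the coordinates turns multiplication by v ^ e into multiplication by v, so
systems over k[X] ^ e become linear systems over k[X]. -/
theorem coord_pow_mul {i : ℕ} (hi : i < p ^ r) (v u : k[X]) :
    coord p r i (v ^ p ^ r * u) = v * coord p r i u := by
  induction v using Polynomial.induction_on' with
  | add f g hf hg => rw [add_pow_char_pow, add_mul, coord_add, hf, hg, add_mul]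
  | monomial m c =>
    ext n
    have he : 0 < p ^ r := pow_pos (Fact.out : p.Prime).pos r
    rw [coeff_coord, monomial_pow, ← C_mul_X_pow_eq_monomial, ← C_mul_X_pow_eq_monomial, mul_assoc,
      mul_assoc, coeff_C_mul, coeff_C_mul, coeff_X_pow_mul', coeff_X_pow_mul', map_mul]
    congr 1
    · rw [RingEquiv.symm_apply_eq]; simp [iterateFrobenius_def]
    · by_cases h : m ≤ n
      · have h' : m * p ^ r ≤ n * p ^ r + i := le_add_right (Nat.mul_le_mul_right _ h)
        rw [if_pos h, if_pos h', coeff_coord]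
        congr 2
        rw [Nat.sub_mul]
        have := Nat.mul_le_mul_right (p ^ r) h
        omega
      · rw [if_neg h, if_neg, map_zero]
        intro h'
        have := Nat.mul_le_mul_right (p ^ r) (Nat.lt_of_not_le h)
        rw [Nat.succ_mul] at this
        omega

theorem natDegree_coord_le (i : ℕ) (u : k[X]) :
    (coord p r i u).natDegree ≤ u.natDegree / p ^ r := by
  rw [natDegree_le_iff_coeff_eq_zero]
  intro n hn
  have he : 0 < p ^ r := pow_pos (Fact.out : p.Prime).pos r
  rw [coeff_coord, coeff_eq_zero_of_natDegree_lt, map_zero]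
  rw [Nat.div_lt_iff_lt_mul he] at hn
  omega

/-- A degree estimate for the leading part of `[u, v] + [u₁, w]`. -/
theorem natDegree_le_of_coord_ne {u u₁ : k[X]} {i j : ℕ} (hi : i < p ^ r) (hj : j < p ^ r)
    (hne : coord p r i u * coord p r j u₁ ≠ coord p r j u * coord p r i u₁) (v w : k[X]) {D : ℕ}
    (hu₁ : u₁.natDegree ≤ D) :
    v.natDegree ≤ D + (u * v ^ p ^ r + u₁ * w ^ p ^ r).natDegree / p ^ r := by
  set g := u * v ^ p ^ r + u₁ * w ^ p ^ r with hg
  have hgi : ∀ l < p ^ r, coord p r l g = v * coord p r l u + w * coord p r l u₁ := by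
    intro l hl
    rw [hg, coord_add, mul_comm u, mul_comm u₁, coord_pow_mul p r hl, coord_pow_mul p r hl]
  -- Cramer's rule for the two equations `hgi i` and `hgi j` in the unknowns v and w.
  have key : (coord p r i u * coord p r j u₁ - coord p r j u * coord p r i u₁) * v =
      coord p r j u₁ * coord p r i g - coord p r i u₁ * coord p r j g := by
    rw [hgi i hi, hgi j hj]; ring
  rcases eq_or_ne v 0 with rfl | hv
  · simp
  have h1 := natDegree_mul (sub_ne_zero.2 hne) hv
  have hb : ∀ l m, (coord p r l u₁ * coord p r m g).natDegree ≤ D + g.natDegree / p ^ r :=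
    fun l m => natDegree_mul_le.trans (add_le_add
      ((natDegree_coord_le p r l u₁).trans ((Nat.div_le_self _ _).trans hu₁))
      (natDegree_coord_le p r m g))
  have h2 := (natDegree_sub_le (coord p r j u₁ * coord p r i g)
    (coord p r i u₁ * coord p r j g)).trans (max_le (hb j i) (hb i j))
  rw [← key, h1] at h2
  omega

/-- The part u v^e + u₁ w^e dominates, and nonproportional coordinates prevent cancellation in it.
With M the larger degree of v, w, either M ≤ D + N or M ≤ 2D + M/e; the latter gives M ≤ 3D because
e ≥ 3. -/
theorem natDegree_le_of_natDegree_bracket_lt (he : 2 < p ^ r) {u u₁ : k[X]} {i j : ℕ}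
    (hi : i < p ^ r) (hj : j < p ^ r)
    (hne : coord p r i u * coord p r j u₁ ≠ coord p r j u * coord p r i u₁) (v w : k[X]) {D N : ℕ}
    (hu : u.natDegree ≤ D) (hu₁ : u₁.natDegree ≤ D)
    (h : (bracket (p ^ r) u v + bracket (p ^ r) u₁ w).natDegree < p ^ r * N) :
    v.natDegree ≤ N + 3 * D ∧ w.natDegree ≤ N + 3 * D := by
  have hv := natDegree_le_of_coord_ne p r hi hj hne v w hu₁
  have hw := natDegree_le_of_coord_ne p r (u := u₁) (u₁ := u) hj hi
    (fun h => hne (by linear_combination h)) w v hu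
  rw [add_comm (u₁ * w ^ p ^ r)] at hw
  set g := u * v ^ p ^ r + u₁ * w ^ p ^ r with hg
  set M := max v.natDegree w.natDegree with hM
  have hgM : g.natDegree ≤ max (p ^ r * N) (p ^ r * D + M) := by
    have h1 : g = (u ^ p ^ r * v + u₁ ^ p ^ r * w) -
        (bracket (p ^ r) u v + bracket (p ^ r) u₁ w) := by
      simp only [hg, bracket]; ring
    have hb : ∀ a b : k[X], a.natDegree ≤ D → b.natDegree ≤ M →
        (a ^ p ^ r * b).natDegree ≤ p ^ r * D + M := fun a b ha hb =>
      natDegree_mul_le.trans (add_le_add (natDegree_pow_le.trans (Nat.mul_le_mul_left _ ha)) hb)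
    rw [h1]
    refine (natDegree_sub_le _ _).trans (max_le (le_max_of_le_right ?_) (le_max_of_le_left h.le))
    exact (natDegree_add_le _ _).trans
      (max_le (hb u v hu (le_max_left _ _)) (hb u₁ w hu₁ (le_max_right _ _)))
  have hMg : M ≤ D + g.natDegree / p ^ r := max_le hv hw
  have hM' : M ≤ N + 3 * D := by
    by_contra! hlt
    have hq := Nat.div_mul_le_self g.natDegree (p ^ r)
    generalize g.natDegree / p ^ r = c at *
    generalize p ^ r = e at *
    clear_value M
    obtain ⟨s, rfl⟩ : ∃ s, M = N + 3 * D + 1 + s := ⟨M - (N + 3 * D + 1), by omega⟩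
    have hc : N + 2 * D + 1 + s ≤ c := by omega
    have h1 := Nat.mul_le_mul_right e hc
    rcases le_max_iff.1 (hq.trans hgM) with h2 | h2 <;> nlinarith
  exact ⟨(le_max_left _ _).trans hM', (le_max_right _ _).trans hM'⟩

/-- Below degree eN there are q^(eN) polynomials, but at most q^(2(N + 3D + 1)) of them are values
of the map. Finite index would force these counts to be comparable, which fails for large N as e ≥
3. -/
theorem not_finiteIndex_range_bracketSum (he : 2 < p ^ r) {u u₁ : k[X]} {i j : ℕ}
    (hi : i < p ^ r) (hj : j < p ^ r)
    (hne : coord p r i u * coord p r j u₁ ≠ coord p r j u * coord p r i u₁) :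
    ¬ (bracketSum p r u u₁).range.FiniteIndex := by
  intro hfin
  set S := (bracketSum p r u u₁).range with hS
  set D := max u.natDegree u₁.natDegree with hD
  set q := Nat.card k with hq
  have hq2 : 2 ≤ q := Finite.one_lt_card
  have key : ∀ N, q ^ N ≤ S.index * q ^ (6 * D + 2) := by
    intro N
    set B := (degreeLT k (p ^ r * N)).toAddSubgroup with hB
    set B' := degreeLT k (N + 3 * D + 1) with hB'
    have : Finite B' := finite_degreeLT _
    have h1 : Nat.card (S.addSubgroupOf B) * S.relIndex B = q ^ (p ^ r * N) := by
      rw [AddSubgroup.relIndex, AddSubgroup.card_mul_index]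
      exact natCard_degreeLT _
    have h2 : S.relIndex B ≤ S.index := Nat.le_of_dvd
      (Nat.pos_of_ne_zero hfin.index_ne_zero) (AddSubgroup.relIndex_dvd_index_of_normal _ _)
    have h3 : Nat.card (S.addSubgroupOf B) ≤ Nat.card (B' × B') := by
      have hx : ∀ x : S.addSubgroupOf B, ∃ y : B' × B',
          bracketSum p r u u₁ (y.1, y.2) = ((x : B) : k[X]) := by
        rintro ⟨⟨x, hxB⟩, y, hy⟩
        have hxB' : x ∈ degreeLT k (p ^ r * N) := hxB
        change bracketSum p r u u₁ y = x at hy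
        -- If eN = 0 the strict bound on `natDegree` is unavailable, but then x = 0.
        rcases Nat.eq_zero_or_pos (p ^ r * N) with h0 | hpos
        · rw [h0, mem_degreeLT] at hxB'
          have : x = 0 := degree_eq_bot.1 (Nat.WithBot.lt_zero_iff.1 (by simpa using hxB'))
          exact ⟨0, (map_zero (bracketSum p r u u₁)).trans this.symm⟩
        have hdeg : (bracket (p ^ r) u y.1 + bracket (p ^ r) u₁ y.2).natDegree < p ^ r * N := by
          rw [← bracketSum_apply, hy]
          rcases eq_or_ne x 0 with rfl | hx0
          · simpa using hpos
          · exact (natDegree_lt_iff_degree_lt hx0).2 (mem_degreeLT.1 hxB')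
        obtain ⟨ha, hb⟩ := natDegree_le_of_natDegree_bracket_lt p r he hi hj hne y.1 y.2
          (le_max_left _ _) (le_max_right _ _) hdeg
        exact ⟨(⟨y.1, mem_degreeLT_of_natDegree_lt (Nat.lt_succ_of_le ha)⟩,
          ⟨y.2, mem_degreeLT_of_natDegree_lt (Nat.lt_succ_of_le hb)⟩), hy⟩
      choose f hf using hx
      refine Nat.card_le_card_of_injective f fun a b hab => ?_
      have := hf a
      rw [hab, hf b] at this
      exact Subtype.ext (Subtype.ext this.symm)
    rw [Nat.card_prod, natCard_degreeLT] at h3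
    have h4 : q ^ (3 * N) ≤ q ^ (p ^ r * N) :=
      Nat.pow_le_pow_right (by omega) (Nat.mul_le_mul_right _ he)
    have h5 : q ^ N * q ^ (2 * N) ≤ (S.index * q ^ (6 * D + 2)) * q ^ (2 * N) := by
      calc q ^ N * q ^ (2 * N) = q ^ (3 * N) := by ring
        _ ≤ Nat.card (S.addSubgroupOf B) * S.relIndex B := h4.trans h1.ge
        _ ≤ (q ^ (N + 3 * D + 1) * q ^ (N + 3 * D + 1)) * S.index := Nat.mul_le_mul h3 h2
        _ = _ := by ring
    exact Nat.le_of_mul_le_mul_right h5 (pow_pos (by omega) _)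
  have h := key (S.index * q ^ (6 * D + 2))
  exact absurd (Nat.lt_pow_self (n := S.index * q ^ (6 * D + 2)) hq2) (not_lt.2 h)

/-- If `[u, k[X]] + [u₁, k[X]]` has finite index, then `u₁ / u` is an `e`-th power. -/
theorem exists_pow_mul_eq_of_finiteIndex (he : 2 < p ^ r) {u u₁ : k[X]} (hu : u ≠ 0)
    (hu₁ : u₁ ≠ 0) (h : (bracketSum p r u u₁).range.FiniteIndex) :
    ∃ f g : k[X], f ≠ 0 ∧ g ≠ 0 ∧ g ^ p ^ r * u₁ = f ^ p ^ r * u := by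
  have hall : ∀ i < p ^ r, ∀ j < p ^ r,
      coord p r i u * coord p r j u₁ = coord p r j u * coord p r i u₁ := by
    intro i hi j hj
    by_contra hne
    exact not_finiteIndex_range_bracketSum p r he hi hj hne h
  obtain ⟨i, hi, hiu⟩ : ∃ i < p ^ r, coord p r i u ≠ 0 := by
    by_contra! h0
    exact hu (coord_ext p r fun i hi => by rw [h0 i hi]; ext; simp [coeff_coord])
  -- Proportional coordinate vectors: an entry of each one serves as the factor for the other.
  have heq : coord p r i u ^ p ^ r * u₁ = coord p r i u₁ ^ p ^ r * u := by
    refine coord_ext p r fun j hj => ?_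
    rw [coord_pow_mul p r hj, coord_pow_mul p r hj, hall i hi j hj, mul_comm]
  refine ⟨coord p r i u₁, coord p r i u, ?_, hiu, heq⟩
  intro h0
  rw [h0, zero_pow (pow_ne_zero r (Fact.out : p.Prime).ne_zero), zero_mul] at heq
  exact mul_ne_zero (pow_ne_zero _ hiu) hu₁ heq

end Coordinates

end FrobeniusBracket

/-! ### Bracket correspondences preserve e-th power ratios -/

namespace FrobeniusBracket

/-- A correspondence between finite-index subgroups of `k[X]`, given by its graph, that is
compatible with the bracket: it comes with a correspondence between subgroups containing the
brackets. -/
structure BracketCorrespondence (k : Type*) [Field k] (e : ℕ) where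
  graph : AddSubgroup (k[X] × k[X])
  bracketGraph : AddSubgroup (k[X] × k[X])
  snd_eq_zero : ∀ {v}, (0, v) ∈ graph → v = 0
  fst_eq_zero : ∀ {u}, (u, 0) ∈ graph → u = 0
  bracket_snd_eq_zero : ∀ {v}, (0, v) ∈ bracketGraph → v = 0
  bracket_fst_eq_zero : ∀ {u}, (u, 0) ∈ bracketGraph → u = 0
  finiteIndex_fst : (graph.map (AddMonoidHom.fst _ _)).FiniteIndex
  finiteIndex_snd : (graph.map (AddMonoidHom.snd _ _)).FiniteIndex
  bracket_mem : ∀ {u u' v v'}, (u, u') ∈ graph → (v, v') ∈ graph →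
    (bracket e u v, bracket e u' v') ∈ bracketGraph

/-- `v / u` is the `e`-th power of a nonzero rational function. -/
def PowRelated {k : Type*} [Field k] (e : ℕ) (u v : k[X]) : Prop :=
  ∃ f g : k[X], f ≠ 0 ∧ g ≠ 0 ∧ g ^ e * v = f ^ e * u

/-- The preimages of A under finitely many multiplications still meet in a subgroup of finite index.
This is how test elements with several multiples in the domain are found. -/
theorem exists_mem_mul_mem_natDegree_gt {k : Type*} [Field k] [Finite k]
    (A : AddSubgroup k[X]) [A.FiniteIndex] (s : Set k[X]) [Finite s] (n : ℕ) :
    ∃ a ∈ A, n < a.natDegree ∧ ∀ c ∈ s, c * a ∈ A := by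
  let B : AddSubgroup k[X] := A ⊓ ⨅ c : s, A.comap (AddMonoidHom.mulLeft (c : k[X]))
  have : (⨅ c : s, A.comap (AddMonoidHom.mulLeft (c : k[X]))).FiniteIndex :=
    AddSubgroup.finiteIndex_iInf fun _ => inferInstance
  have : B.FiniteIndex := inferInstance
  obtain ⟨a, ha, hn⟩ := exists_mem_natDegree_gt B n
  refine ⟨a, ha.1, hn, fun c hc => ?_⟩
  exact AddSubgroup.mem_iInf.1 ha.2 ⟨c, hc⟩

namespace PowRelated

variable {k : Type*} [Field k] {e : ℕ} {u v w : k[X]}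

theorem symm : PowRelated e u v → PowRelated e v u := by
  rintro ⟨f, g, hf, hg, h⟩
  exact ⟨g, f, hg, hf, h.symm⟩

theorem trans : PowRelated e u v → PowRelated e v w → PowRelated e u w := by
  rintro ⟨f, g, hf, hg, h⟩ ⟨f', g', hf', hg', h'⟩
  refine ⟨f * f', g * g', mul_ne_zero hf hf', mul_ne_zero hg hg', ?_⟩
  rw [mul_pow, mul_pow]
  linear_combination g ^ e * h' + f' ^ e * h

theorem pow_mul {c : k[X]} (hc : c ≠ 0) : PowRelated e u (c ^ e * u) :=
  ⟨c, 1, hc, one_ne_zero, by simp⟩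

theorem of_fractionRing {a b : FractionRing k[X]} (ha : a ≠ 0) (hb : b ≠ 0)
    (h : a ^ e * algebraMap k[X] (FractionRing k[X]) u =
      b ^ e * algebraMap k[X] (FractionRing k[X]) v) : PowRelated e u v := by
  obtain ⟨a₁, a₂, ha₂, rfl⟩ := IsFractionRing.div_surjective (A := k[X]) a
  obtain ⟨b₁, b₂, hb₂, rfl⟩ := IsFractionRing.div_surjective (A := k[X]) b
  have ha₂' := nonZeroDivisors.ne_zero ha₂
  have hb₂' := nonZeroDivisors.ne_zero hb₂
  have hinj := IsFractionRing.injective k[X] (FractionRing k[X])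
  have hna : algebraMap k[X] (FractionRing k[X]) a₂ ≠ 0 := by simpa using ha₂'
  have hnb : algebraMap k[X] (FractionRing k[X]) b₂ ≠ 0 := by simpa using hb₂'
  refine ⟨a₁ * b₂, b₁ * a₂, mul_ne_zero ?_ hb₂', mul_ne_zero ?_ ha₂', ?_⟩
  · rintro rfl; simp at ha
  · rintro rfl; simp at hb
  · apply hinj
    simp only [map_mul, map_pow, mul_pow]
    rw [div_pow, div_pow] at h
    field_simp at h
    linear_combination -h

end PowRelated

/-- Compare degrees modulo e: X is not an e-th power. -/
theorem not_powRelated_X_mul {k : Type*} [Field k] {e : ℕ} (he : 1 < e) {w : k[X]} (hw : w ≠ 0) :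
    ¬ PowRelated e w (X * w) := by
  rintro ⟨f, g, hf, hg, h⟩
  have h' : g ^ e * X = f ^ e := mul_right_cancel₀ hw (by rw [← h]; ring)
  have := congrArg natDegree h'
  rw [natDegree_mul (pow_ne_zero _ hg) X_ne_zero, natDegree_X, natDegree_pow, natDegree_pow] at this
  have h1 : e ∣ 1 := (Nat.dvd_add_right (dvd_mul_right e g.natDegree)).1
    (this ▸ dvd_mul_right e f.natDegree)
  exact absurd (Nat.le_of_dvd one_pos h1) (by omega)

theorem pow_ne_self_of_natDegree_pos {k : Type*} [Field k] {n : ℕ} (hn : 1 < n) {h : k[X]}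
    (hh : 0 < h.natDegree) : h ^ n ≠ h := by
  intro heq
  have := congrArg natDegree heq
  rw [natDegree_pow] at this
  nlinarith

namespace BracketCorrespondence

variable {k : Type*} [Field k] {e : ℕ} (Φ : BracketCorrespondence k e)

/-- The inverse correspondence. -/
noncomputable def swap : BracketCorrespondence k e where
  graph := swapSubgroup Φ.graph
  bracketGraph := swapSubgroup Φ.bracketGraph
  snd_eq_zero h := Φ.fst_eq_zero (mem_swapSubgroup.1 h)
  fst_eq_zero h := Φ.snd_eq_zero (mem_swapSubgroup.1 h)
  bracket_snd_eq_zero h := Φ.bracket_fst_eq_zero (mem_swapSubgroup.1 h)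
  bracket_fst_eq_zero h := Φ.bracket_snd_eq_zero (mem_swapSubgroup.1 h)
  finiteIndex_fst := by
    rw [map_fst_swapSubgroup]; exact Φ.finiteIndex_snd
  finiteIndex_snd := by
    rw [map_snd_swapSubgroup]; exact Φ.finiteIndex_fst
  bracket_mem h h' :=
    mem_swapSubgroup.2 (Φ.bracket_mem (mem_swapSubgroup.1 h) (mem_swapSubgroup.1 h'))

/-- The domain of the correspondence. -/
noncomputable def dom : AddSubgroup k[X] := Φ.graph.map (AddMonoidHom.fst _ _)

instance : Φ.dom.FiniteIndex := Φ.finiteIndex_fst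

theorem mem_dom {u : k[X]} : u ∈ Φ.dom ↔ ∃ u', (u, u') ∈ Φ.graph := by
  simp [dom]

variable {Φ}

theorem bracketGraph_unique {u v w : k[X]} (h : (u, v) ∈ Φ.bracketGraph)
    (h' : (u, w) ∈ Φ.bracketGraph) : v = w :=
  sub_eq_zero.1 (Φ.bracket_snd_eq_zero (by simpa using Φ.bracketGraph.sub_mem h h'))

theorem snd_ne_zero {u v : k[X]} (hu : u ≠ 0) (h : (u, v) ∈ Φ.graph) : v ≠ 0 := by
  rintro rfl; exact hu (Φ.fst_eq_zero h)

variable {p : ℕ} [Fact p.Prime] [CharP k p] {r : ℕ} {Φ : BracketCorrespondence k (p ^ r)}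

variable (Φ) in
/-- The part of the bracket correspondence spanned by brackets with two given elements. -/
noncomputable def bracketSumGraph (u u' u₁ u₁' : k[X]) : AddSubgroup (k[X] × k[X]) :=
  (Φ.graph.prod Φ.graph).map
    (((bracketSum p r u u₁).comp (((AddMonoidHom.fst _ _).comp (AddMonoidHom.fst _ _)).prod
        ((AddMonoidHom.fst _ _).comp (AddMonoidHom.snd _ _)))).prod
      ((bracketSum p r u' u₁').comp (((AddMonoidHom.snd _ _).comp (AddMonoidHom.fst _ _)).prod
        ((AddMonoidHom.snd _ _).comp (AddMonoidHom.snd _ _)))))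

theorem mem_bracketSumGraph {u u' u₁ u₁' v v' w w' : k[X]} (hv : (v, v') ∈ Φ.graph)
    (hw : (w, w') ∈ Φ.graph) :
    (bracket (p ^ r) u v + bracket (p ^ r) u₁ w, bracket (p ^ r) u' v' + bracket (p ^ r) u₁' w') ∈
      Φ.bracketSumGraph u u' u₁ u₁' :=
  ⟨((v, v'), (w, w')), ⟨hv, hw⟩, by simp [bracketSum_apply]⟩

theorem bracketSumGraph_le {u u' u₁ u₁' : k[X]} (hu : (u, u') ∈ Φ.graph)
    (hu₁ : (u₁, u₁') ∈ Φ.graph) : Φ.bracketSumGraph u u' u₁ u₁' ≤ Φ.bracketGraph := by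
  rintro _ ⟨⟨⟨v, v'⟩, ⟨w, w'⟩⟩, ⟨hv, hw⟩, rfl⟩
  simpa [bracketSum_apply] using
    Φ.bracketGraph.add_mem (Φ.bracket_mem hu hv) (Φ.bracket_mem hu₁ hw)

variable [Finite k]

/-- Put -f w and g w into the two brackets. The terms with w ^ e cancel by `h`, leaving (u₁^e g -
u^e f) w, and w runs through a finite-index subgroup. -/
theorem finiteIndex_bracketSumGraph_fst {u u₁ f g : k[X]} (u' u₁' : k[X])
    (h : g ^ p ^ r * u₁ = f ^ p ^ r * u) (hN : u₁ ^ p ^ r * g - u ^ p ^ r * f ≠ 0) :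
    ((Φ.bracketSumGraph u u' u₁ u₁').map (AddMonoidHom.fst _ _)).FiniteIndex := by
  let W : AddSubgroup k[X] :=
    Φ.dom.comap (AddMonoidHom.mulLeft f) ⊓ Φ.dom.comap (AddMonoidHom.mulLeft g)
  have := finiteIndex_map_mulLeft W hN
  refine AddSubgroup.finiteIndex_of_le (H := W.map (AddMonoidHom.mulLeft
    (u₁ ^ p ^ r * g - u ^ p ^ r * f))) ?_
  rintro _ ⟨w, ⟨hf, hg⟩, rfl⟩
  obtain ⟨a, ha⟩ := Φ.mem_dom.1 hf
  obtain ⟨b, hb⟩ := Φ.mem_dom.1 hg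
  refine ⟨_, mem_bracketSumGraph (Φ.graph.neg_mem ha) hb, ?_⟩
  have hneg : (-(f * w)) ^ p ^ r = -(f * w) ^ p ^ r := by
    have := map_neg (iterateFrobenius k[X] p r) (f * w)
    simpa [iterateFrobenius_def] using this
  simp only [bracket, AddMonoidHom.coe_mulLeft, AddMonoidHom.coe_fst] at *
  rw [hneg]
  simp only [mul_pow]
  linear_combination (-w ^ p ^ r) * h

theorem finiteIndex_bracketGraph_fst (he : 2 < p ^ r) :
    (Φ.bracketGraph.map (AddMonoidHom.fst _ _)).FiniteIndex := by
  obtain ⟨u, hu, hu0⟩ := exists_mem_ne_zero Φ.dom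
  obtain ⟨h, hh, hdeg⟩ := exists_mem_natDegree_gt (Φ.dom.comap ((AddMonoidHom.mulRight u).comp
    (iterateFrobenius k[X] p r : k[X] →+ k[X]))) 0
  have hh' : h ^ p ^ r * u ∈ Φ.dom := by simpa [iterateFrobenius_def] using hh
  obtain ⟨u', hu'⟩ := Φ.mem_dom.1 hu
  obtain ⟨u₁', hu₁'⟩ := Φ.mem_dom.1 hh'
  -- For u₁ = h^e u the nondegeneracy term is u^e (h^(e²) - h), nonzero as h is not constant.
  have hN : (h ^ p ^ r * u) ^ p ^ r * 1 - u ^ p ^ r * h ≠ 0 := by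
    have h1 : (h ^ p ^ r * u) ^ p ^ r * 1 - u ^ p ^ r * h =
      u ^ p ^ r * (h ^ (p ^ r * p ^ r) - h) := by rw [mul_pow, ← pow_mul]; ring
    rw [h1]
    exact mul_ne_zero (pow_ne_zero _ hu0)
      (sub_ne_zero.2 (pow_ne_self_of_natDegree_pos (by nlinarith) hdeg))
  have := finiteIndex_bracketSumGraph_fst (Φ := Φ) u' u₁' (by simp) hN
  exact AddSubgroup.finiteIndex_of_le (AddSubgroup.map_mono (bracketSumGraph_le hu' hu₁'))

/-- Finite index is transported along the bracket correspondence: the sum of brackets with u and u₁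
has finite index, hence so does the sum with u' and u₁', and the counting argument applies to the
latter. -/
theorem powRelated_of_ne (he : 2 < p ^ r) {u u' u₁ u₁' f g : k[X]} (hu : (u, u') ∈ Φ.graph)
    (hu₁ : (u₁, u₁') ∈ Φ.graph) (hu0 : u ≠ 0) (hu₁0 : u₁ ≠ 0)
    (h : g ^ p ^ r * u₁ = f ^ p ^ r * u) (hN : u₁ ^ p ^ r * g - u ^ p ^ r * f ≠ 0) :
    PowRelated (p ^ r) u' u₁' := by
  refine exists_pow_mul_eq_of_finiteIndex p r he (snd_ne_zero hu0 hu) (snd_ne_zero hu₁0 hu₁) ?_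
  set J := Φ.bracketSumGraph u u' u₁ u₁' with hJ
  have hfst : (J.map (AddMonoidHom.fst _ _)).FiniteIndex :=
    finiteIndex_bracketSumGraph_fst u' u₁' h hN
  have hJle : J ≤ Φ.bracketGraph := bracketSumGraph_le hu hu₁
  have hrel : J.relIndex Φ.bracketGraph ≠ 0 := by
    -- In `bracketGraph` the first entry determines the second, so J is recovered from its first
    -- projection.
    have heq : ((J.map (AddMonoidHom.fst _ _)).comap (AddMonoidHom.fst _ _)) ⊓ Φ.bracketGraph
        ≤ J := by
      rintro ⟨a, b⟩ ⟨⟨⟨a', b'⟩, hm, rfl⟩, hab⟩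
      have := bracketGraph_unique hab (hJle hm)
      subst this
      exact hm
    intro h0
    have h1 := AddSubgroup.relIndex_eq_zero_of_le_left heq h0
    rw [AddSubgroup.inf_relIndex_right] at h1
    exact (finiteIndex_comap _ _).index_ne_zero (AddSubgroup.index_eq_zero_of_relIndex_eq_zero h1)
  have hB : (Φ.bracketGraph.map (AddMonoidHom.snd _ _)).FiniteIndex := by
    rw [← map_fst_swapSubgroup]
    exact finiteIndex_bracketGraph_fst (Φ := Φ.swap) he
  have hsnd : (J.map (AddMonoidHom.snd _ _)).FiniteIndex := by
    rw [AddSubgroup.finiteIndex_iff, ← AddSubgroup.relIndex_mul_index (AddSubgroup.map_mono hJle)]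
    exact mul_ne_zero (relIndex_map_ne_zero _ hrel) hB.index_ne_zero
  refine AddSubgroup.finiteIndex_of_le (H := J.map (AddMonoidHom.snd _ _)) ?_
  rintro _ ⟨_, ⟨⟨⟨v, v'⟩, ⟨w, w'⟩⟩, -, rfl⟩, rfl⟩
  exact ⟨(v', w'), rfl⟩

theorem PowRelated.map (he : 2 < p ^ r) {u u' u₁ u₁' : k[X]} (hu : (u, u') ∈ Φ.graph)
    (hu₁ : (u₁, u₁') ∈ Φ.graph) (hu0 : u ≠ 0) (hu₁0 : u₁ ≠ 0)
    (h : PowRelated (p ^ r) u u₁) : PowRelated (p ^ r) u' u₁' := by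
  obtain ⟨f, g, hf, hg, h⟩ := h
  by_cases hN : u₁ ^ p ^ r * g - u ^ p ^ r * f = 0
  -- In the degenerate case pass through a third vector c^e u on the same line; it is in
  -- nondegenerate position to both u and u₁.
  · obtain ⟨c, hc, hdeg⟩ := exists_mem_natDegree_gt (Φ.dom.comap ((AddMonoidHom.mulRight u).comp
      (iterateFrobenius k[X] p r : k[X] →+ k[X]))) 0
    have hc' : c ^ p ^ r * u ∈ Φ.dom := by simpa [iterateFrobenius_def] using hc
    obtain ⟨w, hw⟩ := Φ.mem_dom.1 hc'
    have hc0 : c ≠ 0 := by rintro rfl; simp at hdeg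
    have hcu : c ^ p ^ r * u ≠ 0 := mul_ne_zero (pow_ne_zero _ hc0) hu0
    have hne := sub_ne_zero.2 (pow_ne_self_of_natDegree_pos
      (show 1 < p ^ r * p ^ r by nlinarith) hdeg)
    refine (powRelated_of_ne he (f := c) (g := 1) hu hw hu0 hcu (by simp) ?_).trans
      (powRelated_of_ne he (f := c * g) (g := f) hu₁ hw hu₁0 hcu ?_ ?_).symm
    · have h1 : (c ^ p ^ r * u) ^ p ^ r * 1 - u ^ p ^ r * c =
        u ^ p ^ r * (c ^ (p ^ r * p ^ r) - c) := by rw [mul_pow, ← pow_mul]; ring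
      rw [h1]
      exact mul_ne_zero (pow_ne_zero _ hu0) hne
    · rw [mul_pow]; linear_combination (-c ^ p ^ r) * h
    · have h1 : (c ^ p ^ r * u) ^ p ^ r * f - u₁ ^ p ^ r * (c * g) =
        u ^ p ^ r * f * (c ^ (p ^ r * p ^ r) - c) := by
        rw [mul_pow, ← pow_mul]; linear_combination -c * hN
      rw [h1]
      exact mul_ne_zero (mul_ne_zero (pow_ne_zero _ hu0) hf) hne
  · exact powRelated_of_ne he hu hu₁ hu0 hu₁0 h hN

end BracketCorrespondence

end FrobeniusBracket

/-! ### Semilinearity of the correspondence -/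

namespace FrobeniusBracket

namespace BracketCorrespondence

variable {k : Type*} [Field k] [Finite k] {p : ℕ} [Fact p.Prime] [CharP k p] {r : ℕ}
  {Φ : BracketCorrespondence k (p ^ r)}

local notation "ι" => algebraMap k[X] (FractionRing k[X])

theorem pow_injective {R : Type*} [CommRing R] [IsReduced R] [CharP R p] (r : ℕ) {a b : R}
    (h : a ^ p ^ r = b ^ p ^ r) : a = b :=
  iterateFrobenius_inj R p r (by simpa [iterateFrobenius_def] using h)

/-- The step of the fundamental theorem of projective geometry which compares the factors at
two independent vectors. -/
theorem eq_pow_mul_of_add {L : Type*} [Field L] [CharP L p] {a b w z q s t : L} (ha : a ≠ 0)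
    (hb : b ≠ 0) (hw : w = t ^ p ^ r * a) (hz : z = s ^ p ^ r * b)
    (hwz : w + z = q ^ p ^ r * (a + b))
    (hne : ∀ x y : L, x ≠ 0 → y ≠ 0 → x ^ p ^ r * a ≠ y ^ p ^ r * b) : z = t ^ p ^ r * b := by
  have key : (t - q) ^ p ^ r * a = (q - s) ^ p ^ r * b := by
    rw [sub_pow_char_pow, sub_pow_char_pow]
    linear_combination hwz - hw - hz
  have hpos : p ^ r ≠ 0 := pow_ne_zero _ (Fact.out : p.Prime).ne_zero
  rcases eq_or_ne (t - q) 0 with htq | htq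
  · rw [htq, zero_pow hpos, zero_mul, eq_comm, mul_eq_zero, pow_eq_zero_iff hpos] at key
    rw [hz, sub_eq_zero.1 htq, sub_eq_zero.1 (key.resolve_right hb)]
  · rcases eq_or_ne (q - s) 0 with hqs | hqs
    · rw [hqs, zero_pow hpos, zero_mul, mul_eq_zero, pow_eq_zero_iff hpos] at key
      exact absurd (key.resolve_right ha) htq
    · exact absurd key (hne _ _ htq hqs)

theorem exists_eq_pow_mul (he : 2 < p ^ r) {c u u' w : k[X]} (hu : (u, u') ∈ Φ.graph)
    (hw : (c ^ p ^ r * u, w) ∈ Φ.graph) : ∃ t : FractionRing k[X], ι w = t ^ p ^ r * ι u' := by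
  have hz : (0 : FractionRing k[X]) ^ p ^ r = 0 := zero_pow (by omega)
  by_cases h0 : c = 0 ∨ u = 0
  · refine ⟨0, ?_⟩
    have : c ^ p ^ r * u = 0 := by
      rcases h0 with rfl | rfl
      · rw [zero_pow (by omega), zero_mul]
      · rw [mul_zero]
    rw [this] at hw
    rw [Φ.snd_eq_zero hw, hz]
    simp
  · push Not at h0
    obtain ⟨f, g, hf, hg, h⟩ := PowRelated.map he hu hw h0.2
      (mul_ne_zero (pow_ne_zero _ h0.1) h0.2) (PowRelated.pow_mul h0.1)
    refine ⟨ι f / ι g, ?_⟩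
    have hg' : ι g ≠ 0 := by simpa using hg
    have := congrArg ι h
    simp only [map_mul, map_pow] at this
    rw [div_pow]
    field_simp
    linear_combination this

/-- The factors at u, v and u + v must coincide because u' and v' lie on different lines; this
independence comes from line preservation for the inverse correspondence. -/
theorem eq_pow_mul_of_not_powRelated (he : 2 < p ^ r) {c u u' w v v' z : k[X]}
    {t : FractionRing k[X]}
    (hu0 : u ≠ 0) (hu : (u, u') ∈ Φ.graph) (hw : (c ^ p ^ r * u, w) ∈ Φ.graph)
    (hv0 : v ≠ 0) (hv : (v, v') ∈ Φ.graph) (hz : (c ^ p ^ r * v, z) ∈ Φ.graph)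
    (hne : ¬ PowRelated (p ^ r) u v) (ht : ι w = t ^ p ^ r * ι u') :
    ι z = t ^ p ^ r * ι v' := by
  obtain ⟨s, hs⟩ := exists_eq_pow_mul he hv hz
  have hadd : (c ^ p ^ r * (u + v), w + z) ∈ Φ.graph := by
    rw [mul_add]; exact Φ.graph.add_mem hw hz
  obtain ⟨q, hq⟩ := exists_eq_pow_mul he (Φ.graph.add_mem hu hv) hadd
  simp only [map_add] at hq
  have hu' : ι u' ≠ 0 := by simpa using snd_ne_zero hu0 hu
  have hv' : ι v' ≠ 0 := by simpa using snd_ne_zero hv0 hv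
  exact eq_pow_mul_of_add hu' hv' ht hs hq fun x y hx hy hxy =>
    hne (PowRelated.map (Φ := Φ.swap) he hu hv (snd_ne_zero hu0 hu) (snd_ne_zero hv0 hv)
      (PowRelated.of_fractionRing hx hy hxy))

variable (Φ) in
/-- The correspondence takes `c ^ e u` to `t ^ e u'` whenever it takes `u` to `u'`. -/
def IsMultiplier (c : k[X]) (t : FractionRing k[X]) : Prop :=
  ∀ u u' w, (u, u') ∈ Φ.graph → (c ^ p ^ r * u, w) ∈ Φ.graph → ι w = t ^ p ^ r * ι u'

-- Any nonzero y lies off the line of u or off that of v, where u and v are independent. So the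
-- factor at u passes to v and then to y, directly or through v.
variable (Φ) in
theorem exists_isMultiplier (he : 2 < p ^ r) (c : k[X]) : ∃ t, Φ.IsMultiplier c t := by
  obtain ⟨u, hu, hudeg, hcu⟩ := exists_mem_mul_mem_natDegree_gt Φ.dom {c ^ p ^ r} 0
  obtain ⟨x, hx, hxdeg, hcx⟩ := exists_mem_mul_mem_natDegree_gt Φ.dom
    {X, c ^ p ^ r, c ^ p ^ r * X} 0
  have hu0 : u ≠ 0 := by rintro rfl; simp at hudeg
  have hx0 : x ≠ 0 := by rintro rfl; simp at hxdeg
  -- Of x and X x at least one is off the line of u, since the two lie on different lines.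
  obtain ⟨v, hv0, hv, hcv, huv⟩ : ∃ v, v ≠ 0 ∧ v ∈ Φ.dom ∧ c ^ p ^ r * v ∈ Φ.dom ∧
      ¬ PowRelated (p ^ r) u v := by
    by_cases h : PowRelated (p ^ r) u x
    · refine ⟨X * x, mul_ne_zero X_ne_zero hx0, hcx X (by simp), ?_, fun h' =>
        not_powRelated_X_mul (by omega) hx0 (h.symm.trans h')⟩
      rw [← mul_assoc]
      exact hcx _ (by simp)
    · exact ⟨x, hx0, hx, hcx _ (by simp), h⟩
  obtain ⟨u', hu'⟩ := Φ.mem_dom.1 hu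
  obtain ⟨v', hv'⟩ := Φ.mem_dom.1 hv
  obtain ⟨w, hw⟩ := Φ.mem_dom.1 (hcu (c ^ p ^ r) (by simp))
  obtain ⟨z, hz⟩ := Φ.mem_dom.1 hcv
  obtain ⟨t, ht⟩ := exists_eq_pow_mul he hu' hw
  have htv := eq_pow_mul_of_not_powRelated he hu0 hu' hw hv0 hv' hz huv ht
  refine ⟨t, fun y y' q hy hq => ?_⟩
  rcases eq_or_ne y 0 with rfl | hy0
  · rw [mul_zero] at hq
    rw [Φ.snd_eq_zero hq, Φ.snd_eq_zero hy]; simp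
  by_cases h : PowRelated (p ^ r) u y
  · exact eq_pow_mul_of_not_powRelated he hv0 hv' hz hy0 hy hq
      (fun h' => huv (h.trans h'.symm)) htv
  · exact eq_pow_mul_of_not_powRelated he hu0 hu' hw hy0 hy hq h ht

variable (Φ) in
/-- The multiplier of a polynomial. -/
noncomputable def multiplier (he : 2 < p ^ r) (c : k[X]) : FractionRing k[X] :=
  (Φ.exists_isMultiplier he c).choose

theorem isMultiplier_multiplier (he : 2 < p ^ r) (c : k[X]) :
    Φ.IsMultiplier c (Φ.multiplier he c) := (Φ.exists_isMultiplier he c).choose_spec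

/-- To identify a multiplier it suffices to test one nonzero element. -/
theorem multiplier_eq (he : 2 < p ^ r) {c u u' w : k[X]} {t : FractionRing k[X]} (hu0 : u ≠ 0)
    (hu : (u, u') ∈ Φ.graph) (hw : (c ^ p ^ r * u, w) ∈ Φ.graph) (h : ι w = t ^ p ^ r * ι u') :
    Φ.multiplier he c = t := by
  have h0 : ι u' ≠ 0 := by simpa using snd_ne_zero hu0 hu
  exact pow_injective r (mul_right_cancel₀ h0
    ((isMultiplier_multiplier he c _ _ _ hu hw).symm.trans h))

variable (Φ) in
/-- The multiplier as a ring homomorphism. -/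
noncomputable def multiplierHom (he : 2 < p ^ r) : k[X] →+* FractionRing k[X] where
  toFun := Φ.multiplier he
  map_one' := by
    obtain ⟨u, hu, hu0⟩ := exists_mem_ne_zero Φ.dom
    obtain ⟨u', hu'⟩ := Φ.mem_dom.1 hu
    exact multiplier_eq he hu0 hu' (by simpa using hu') (by simp)
  map_zero' := by
    obtain ⟨u, hu, hu0⟩ := exists_mem_ne_zero Φ.dom
    obtain ⟨u', hu'⟩ := Φ.mem_dom.1 hu
    have hpos : p ^ r ≠ 0 := by omega
    refine multiplier_eq he (w := 0) hu0 hu' ?_ (by rw [zero_pow hpos]; simp)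
    rw [zero_pow hpos, zero_mul]; exact Φ.graph.zero_mem
  map_mul' c d := by
    obtain ⟨u, hu, hudeg, hcu⟩ := exists_mem_mul_mem_natDegree_gt Φ.dom
      {d ^ p ^ r, c ^ p ^ r * d ^ p ^ r} 0
    have hu0 : u ≠ 0 := by rintro rfl; simp at hudeg
    obtain ⟨u', hu'⟩ := Φ.mem_dom.1 hu
    obtain ⟨v, hv⟩ := Φ.mem_dom.1 (hcu (d ^ p ^ r) (by simp))
    obtain ⟨w, hw⟩ := Φ.mem_dom.1 (hcu (c ^ p ^ r * d ^ p ^ r) (by simp))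
    refine multiplier_eq he hu0 hu' (by rw [mul_pow]; exact hw) ?_
    rw [mul_assoc] at hw
    rw [isMultiplier_multiplier he c _ _ _ hv hw, isMultiplier_multiplier he d _ _ _ hu' hv]
    ring
  map_add' c d := by
    obtain ⟨u, hu, hudeg, hcu⟩ := exists_mem_mul_mem_natDegree_gt Φ.dom
      {c ^ p ^ r, d ^ p ^ r} 0
    have hu0 : u ≠ 0 := by rintro rfl; simp at hudeg
    obtain ⟨u', hu'⟩ := Φ.mem_dom.1 hu
    obtain ⟨v, hv⟩ := Φ.mem_dom.1 (hcu (c ^ p ^ r) (by simp))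
    obtain ⟨w, hw⟩ := Φ.mem_dom.1 (hcu (d ^ p ^ r) (by simp))
    have hvw := Φ.graph.add_mem hv hw
    refine multiplier_eq he hu0 hu' (w := v + w) (by
      rw [add_pow_char_pow, add_mul]; exact hvw) ?_
    rw [map_add, isMultiplier_multiplier he c _ _ _ hu' hv,
      isMultiplier_multiplier he d _ _ _ hu' hw, add_pow_char_pow]
    ring

variable (Φ) in
/-- The multipliers have a common denominator. -/
theorem exists_common_denominator (he : 2 < p ^ r) :
    ∃ d : k[X], d ≠ 0 ∧ ∀ c, ∃ f, ι f = ι d * Φ.multiplierHom he c ^ p ^ r := by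
  obtain ⟨u, hu, hu0⟩ := exists_mem_ne_zero Φ.dom
  obtain ⟨u', hu'⟩ := Φ.mem_dom.1 hu
  set A : AddSubgroup k[X] := Φ.dom.comap ((AddMonoidHom.mulRight u).comp
    (iterateFrobenius k[X] p r : k[X] →+ k[X])) with hA
  -- On A the element u' clears the e-th powers of multipliers. One denominator b handles the
  -- finitely many coset representatives, so b u' works for all c.
  have : Finite (k[X] ⧸ A) := AddSubgroup.finiteIndex_iff_finite_quotient.1 inferInstance
  obtain ⟨b, hb⟩ := IsLocalization.exist_integer_multiples_of_finite (nonZeroDivisors k[X])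
    (fun x : k[X] ⧸ A => Φ.multiplierHom he x.out ^ p ^ r)
  refine ⟨b * u', mul_ne_zero (nonZeroDivisors.coe_ne_zero b) (snd_ne_zero hu0 hu'), fun c => ?_⟩
  obtain ⟨a, ha⟩ := hb (QuotientAddGroup.mk c)
  set c' : k[X] := (QuotientAddGroup.mk c : k[X] ⧸ A).out with hc'
  have hmem : c - c' ∈ A := by
    have := QuotientAddGroup.eq.1 (QuotientAddGroup.out_eq' (QuotientAddGroup.mk c : k[X] ⧸ A))
    rwa [neg_add_eq_sub] at this
  have hmem' : (c - c') ^ p ^ r * u ∈ Φ.dom := by simpa [hA, iterateFrobenius_def] using hmem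
  obtain ⟨w, hw⟩ := Φ.mem_dom.1 hmem'
  have h1 := isMultiplier_multiplier he _ _ _ _ hu' hw
  change ι w = Φ.multiplierHom he (c - c') ^ p ^ r * ι u' at h1
  rw [map_sub, sub_pow_char_pow] at h1
  refine ⟨b * w + a * u', ?_⟩
  rw [Algebra.smul_def] at ha
  simp only [map_add, map_mul]
  linear_combination ι b * h1 + ι u' * ha

/-- The common denominator serves T(c^n)^e = (T(c)^e)^n for all n, so T(c)^e is almost integral,
hence integral. Then T(c) is integral, and k[X] is integrally closed. -/
theorem multiplierHom_mem_range (he : 2 < p ^ r) (c : k[X]) :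
    ∃ f, ι f = Φ.multiplierHom he c := by
  obtain ⟨d, hd, h⟩ := Φ.exists_common_denominator he
  have hal : IsAlmostIntegral k[X] (Φ.multiplierHom he c ^ p ^ r) := by
    refine ⟨d, mem_nonZeroDivisors_of_ne_zero hd, fun n => ?_⟩
    obtain ⟨f, hf⟩ := h (c ^ n)
    refine ⟨f, ?_⟩
    rw [hf, Algebra.smul_def, map_pow]; ring
  have hint : IsIntegral k[X] (Φ.multiplierHom he c) :=
    IsIntegral.of_pow (by omega) hal.isIntegral
  exact IsIntegrallyClosed.isIntegral_iff.1 hint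

variable (Φ) in
/-- The multiplier as a ring endomorphism of `k[X]`. -/
noncomputable def twist (he : 2 < p ^ r) : k[X] →+* k[X] where
  toFun c := (multiplierHom_mem_range (Φ := Φ) he c).choose
  map_one' := IsFractionRing.injective k[X] (FractionRing k[X]) <|
    (multiplierHom_mem_range (Φ := Φ) he _).choose_spec.trans <| by
      rw [map_one, map_one]
  map_zero' := IsFractionRing.injective k[X] (FractionRing k[X]) <|
    (multiplierHom_mem_range (Φ := Φ) he _).choose_spec.trans <| by
      rw [map_zero, map_zero]
  map_mul' c d := IsFractionRing.injective k[X] (FractionRing k[X]) <|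
    (multiplierHom_mem_range (Φ := Φ) he _).choose_spec.trans <| by
      rw [map_mul (algebraMap k[X] (FractionRing k[X])),
        (multiplierHom_mem_range (Φ := Φ) he c).choose_spec,
        (multiplierHom_mem_range (Φ := Φ) he d).choose_spec, map_mul]
  map_add' c d := IsFractionRing.injective k[X] (FractionRing k[X]) <|
    (multiplierHom_mem_range (Φ := Φ) he _).choose_spec.trans <| by
      rw [map_add (algebraMap k[X] (FractionRing k[X])),
        (multiplierHom_mem_range (Φ := Φ) he c).choose_spec,
        (multiplierHom_mem_range (Φ := Φ) he d).choose_spec, map_add]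

theorem algebraMap_twist (he : 2 < p ^ r) (c : k[X]) :
    ι (Φ.twist he c) = Φ.multiplierHom he c :=
  (multiplierHom_mem_range (Φ := Φ) he c).choose_spec

theorem eq_twist_pow_mul (he : 2 < p ^ r) {c u u' w : k[X]} (hu : (u, u') ∈ Φ.graph)
    (hw : (c ^ p ^ r * u, w) ∈ Φ.graph) : w = Φ.twist he c ^ p ^ r * u' := by
  apply IsFractionRing.injective k[X] (FractionRing k[X])
  rw [map_mul, map_pow, algebraMap_twist]
  exact isMultiplier_multiplier he c u u' w hu hw

theorem twist_swap_twist (he : 2 < p ^ r) (c : k[X]) :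
    Φ.swap.twist he (Φ.twist he c) = c := by
  obtain ⟨u, hu, hudeg, hcu⟩ := exists_mem_mul_mem_natDegree_gt Φ.dom {c ^ p ^ r} 0
  have hu0 : u ≠ 0 := by rintro rfl; simp at hudeg
  obtain ⟨u', hu'⟩ := Φ.mem_dom.1 hu
  obtain ⟨w, hw⟩ := Φ.mem_dom.1 (hcu (c ^ p ^ r) (by simp))
  have h1 := eq_twist_pow_mul he hu' hw
  rw [h1] at hw
  have h2 := eq_twist_pow_mul (Φ := Φ.swap) he (mem_swapSubgroup.2 hu') (mem_swapSubgroup.2 hw)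
  exact (pow_injective r (mul_right_cancel₀ hu0 h2)).symm

variable (Φ) in
/-- The multiplier as a ring automorphism of `k[X]`. -/
noncomputable def twistEquiv (he : 2 < p ^ r) : k[X] ≃+* k[X] :=
  RingEquiv.ofRingHom (Φ.twist he) (Φ.swap.twist he)
    (RingHom.ext fun c => twist_swap_twist (Φ := Φ.swap) he c)
    (RingHom.ext fun c => twist_swap_twist he c)

theorem exists_mem_pow_mul_mem (A : AddSubgroup k[X]) [A.FiniteIndex] (n : ℕ) (s : Set k[X])
    [Finite s] (m : ℕ) : ∃ h : k[X], m < h.natDegree ∧ ∀ u ∈ s, h ^ p ^ n * u ∈ A := by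
  have : (⨅ u : s, A.comap ((AddMonoidHom.mulRight (u : k[X])).comp
      (iterateFrobenius k[X] p n : k[X] →+ k[X]))).FiniteIndex :=
    AddSubgroup.finiteIndex_iInf fun _ => inferInstance
  obtain ⟨h, hh, hn⟩ := exists_mem_natDegree_gt (⨅ u : s, A.comap
    ((AddMonoidHom.mulRight (u : k[X])).comp (iterateFrobenius k[X] p n : k[X] →+ k[X]))) m
  refine ⟨h, hn, fun u hu => ?_⟩
  have := AddSubgroup.mem_iInf.1 hh ⟨u, hu⟩
  simpa [iterateFrobenius_def] using this

/-- The correspondence is semilinear over `k[X]`. -/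
theorem eq_twist_mul (he : 2 < p ^ r) {d u u' w : k[X]} (hu : (u, u') ∈ Φ.graph)
    (hw : (d * u, w) ∈ Φ.graph) : w = Φ.twist he d * u' := by
  -- With H = h^e, both H v and H^e u are multiples by e-th powers, so their images are already
  -- known.
  obtain ⟨h, hdeg, hh⟩ := exists_mem_pow_mul_mem (p := p) Φ.dom (r + r) {u, d * u} 0
  obtain ⟨v, hv, hvdeg, hvs⟩ := exists_mem_mul_mem_natDegree_gt Φ.dom
    {h ^ p ^ r, d ^ p ^ r, d ^ p ^ r * h ^ p ^ r} 0
  have hv0 : v ≠ 0 := by rintro rfl; simp at hvdeg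
  have hpow : h ^ p ^ (r + r) = (h ^ p ^ r) ^ p ^ r := by rw [pow_add, pow_mul]
  rw [hpow] at hh
  obtain ⟨x, hx⟩ := Φ.mem_dom.1 (hh u (by simp))
  obtain ⟨y, hy⟩ := Φ.mem_dom.1 (hh (d * u) (by simp))
  obtain ⟨v', hv'⟩ := Φ.mem_dom.1 hv
  obtain ⟨a, ha⟩ := Φ.mem_dom.1 (hvs (h ^ p ^ r) (by simp))
  obtain ⟨b, hb⟩ := Φ.mem_dom.1 (hvs (d ^ p ^ r) (by simp))
  obtain ⟨c, hc⟩ := Φ.mem_dom.1 (hvs (d ^ p ^ r * h ^ p ^ r) (by simp))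
  have hx' := eq_twist_pow_mul he hu hx
  have hy' := eq_twist_pow_mul he hw hy
  have ha' := eq_twist_pow_mul he hv' ha
  have hb' := eq_twist_pow_mul he hv' hb
  rw [mul_assoc] at hc
  have hc' := eq_twist_pow_mul he ha hc
  have h1 := Φ.bracketGraph.sub_mem (Φ.bracket_mem hy hv') (Φ.bracket_mem hw ha)
  have h2 := Φ.bracketGraph.sub_mem (Φ.bracket_mem hx hb) (Φ.bracket_mem hu hc)
  -- Both differences equal (H^(e²) - H) d^e u^e v. On the image side the left one contains w^e and
  -- the right one (T(d) u')^e.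
  have hfst : bracket (p ^ r) ((h ^ p ^ r) ^ p ^ r * (d * u)) v - bracket (p ^ r) (d * u) (h ^ p ^ r * v) =
      bracket (p ^ r) ((h ^ p ^ r) ^ p ^ r * u) (d ^ p ^ r * v) - bracket (p ^ r) u (d ^ p ^ r * (h ^ p ^ r * v)) := by
    simp only [bracket, mul_pow]; ring
  simp only [Prod.mk_sub_mk, hfst] at h1 h2
  have hsnd := bracketGraph_unique h1 h2
  subst hx' hy' ha' hb' hc'
  have hhe : ∀ c : k[X], Φ.twist he (c ^ p ^ r) = Φ.twist he c ^ p ^ r := fun c => map_pow _ _ _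
  simp only [bracket, mul_pow, hhe] at hsnd
  set T := Φ.twist he h with hT
  have hTne : (T ^ p ^ r) ^ (p ^ r) ^ 2 - T ^ p ^ r ≠ 0 := by
    have hpos : 0 < (h ^ p ^ r).natDegree := by
      rw [natDegree_pow]; exact Nat.mul_pos (by omega) hdeg
    have hne := sub_ne_zero.2 (pow_ne_self_of_natDegree_pos (show 1 < (p ^ r) ^ 2 by nlinarith) hpos)
    have := (map_ne_zero_iff (Φ.twistEquiv he) (Φ.twistEquiv he).injective).2 hne
    rw [map_sub, map_pow, map_pow] at this
    exact this
  have hv'0 := snd_ne_zero hv0 hv'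
  have hfac : ((T ^ p ^ r) ^ (p ^ r) ^ 2 - T ^ p ^ r) * v' * (w ^ p ^ r - (Φ.twist he d * u') ^ p ^ r) = 0 := by
    rw [mul_pow]
    linear_combination hsnd
  refine pow_injective r (sub_eq_zero.1 ?_)
  exact (mul_eq_zero.1 hfac).resolve_left (mul_ne_zero hTne hv'0)

/-- Compute the image of c u v both as (c v) u and as (c u) v, then cancel T(c). -/
theorem mul_twist_eq (he : 2 < p ^ r) {u u' v v' : k[X]} (hu : (u, u') ∈ Φ.graph)
    (hv : (v, v') ∈ Φ.graph) : u' * Φ.twist he v = v' * Φ.twist he u := by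
  rcases eq_or_ne u 0 with rfl | hu0
  · rw [Φ.snd_eq_zero hu]; simp
  obtain ⟨c, hc, hdeg, hcs⟩ := exists_mem_mul_mem_natDegree_gt Φ.dom {u * v} 0
  obtain ⟨w, hw⟩ := Φ.mem_dom.1 (hcs (u * v) (by simp))
  have h1 := eq_twist_mul (d := c * v) he hu (by convert hw using 2; ring)
  have h2 := eq_twist_mul (d := c * u) he hv (by convert hw using 2; ring)
  have hc0 : Φ.twist he c ≠ 0 := (map_ne_zero_iff (Φ.twistEquiv he) (Φ.twistEquiv he).injective).2
    (by rintro rfl; simp at hdeg)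
  refine mul_left_cancel₀ hc0 ?_
  rw [map_mul] at h1 h2
  linear_combination h2 - h1

end BracketCorrespondence

end FrobeniusBracket

namespace FrobeniusBracket

/-! ### Ring automorphisms of k[X] -/

section Affine

variable {k : Type*} [Field k]

/-- Every ring automorphism of `k[X]` is the composition of an affine substitution with an
automorphism of the field of coefficients. -/
theorem exists_affine_of_ringEquiv [Finite k] (T : k[X] ≃+* k[X]) :
    ∃ (σ : k ≃+* k) (α β : k), α ≠ 0 ∧
      ∀ f : k[X], T f = (f.comp (C α * X + C β)).map σ.toRingHom := by
  have hconst : ∀ a : k, T (C a) = C ((T (C a)).coeff 0) := by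
    intro a
    rcases eq_or_ne a 0 with rfl | ha
    · simp
    · have : IsUnit (T (C a)) := (isUnit_C.2 ha.isUnit).map T
      exact eq_C_of_natDegree_eq_zero (natDegree_eq_zero_of_isUnit this)
  let σ₀ : k →+* k := (constantCoeff (R := k)).comp (T.toRingHom.comp C)
  have hσ₀ : ∀ a, T (C a) = C (σ₀ a) := fun a => by
    rw [hconst a]; simp [σ₀]
  let σ : k ≃+* k := RingEquiv.ofBijective σ₀ (Finite.injective_iff_bijective.1 σ₀.injective)
  have hσ : ∀ a, T (C a) = C (σ a) := hσ₀
  have hT : ∀ f, T f = (f.map σ.toRingHom).comp (T X) := by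
    intro f
    induction f using Polynomial.induction_on' with
    | add f g hf hg => rw [map_add, hf, hg, Polynomial.map_add, add_comp]
    | monomial n a =>
      rw [← C_mul_X_pow_eq_monomial, map_mul, map_pow, hσ]; simp
  -- The preimage of X exhibits X as a composition with T X, and degrees multiply under composition.
  have hdeg : (T X).natDegree = 1 := by
    have h1 := hT (T.symm X)
    rw [T.apply_symm_apply] at h1
    have h2 := congrArg natDegree h1
    rw [natDegree_X, natDegree_comp] at h2
    exact Nat.eq_one_of_mul_eq_one_left h2.symm
  have hlin := eq_X_add_C_of_natDegree_le_one hdeg.le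
  set a := (T X).coeff 1 with ha
  set b := (T X).coeff 0 with hb
  have ha0 : a ≠ 0 := by
    rw [ha, ← hdeg]
    exact leadingCoeff_ne_zero.2 (by rintro h; simp [h] at hdeg)
  refine ⟨σ, σ.symm a, σ.symm b, by simpa using ha0, fun f => ?_⟩
  rw [hT, hlin, Polynomial.map_comp]
  simp

end Affine

/-! ### Continuous extension to k((t)) -/

section Laurent

open Topology

variable {k : Type*} [Field k]

theorem LaurentSeries.mem_nhds_zero_iff {s : Set (LaurentSeries k)} :
    s ∈ 𝓝 (0 : LaurentSeries k) ↔
      ∃ D : ℕ, {f : LaurentSeries k | ∀ n : ℤ, n < D → f.coeff n = 0} ⊆ s := by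
  rw [Valued.mem_nhds_zero]
  constructor
  · rintro ⟨γ, hγ⟩
    set c := MonoidWithZeroHom.ValueGroup₀.embedding γ.1 with hc
    -- This D is at least 1 - log c, which makes exp(-D) strictly smaller than c.
    refine ⟨(-(WithZero.log c - 1)).toNat, fun f hf => hγ ?_⟩
    rw [Set.mem_ofPred_eq, Valuation.restrict_lt_iff_lt_embedding, ← hc]
    have hlt : WithZero.exp (-(((-(WithZero.log c - 1)).toNat : ℕ) : ℤ)) < c := by
      rw [← WithZero.lt_log_iff_exp_lt (by simp [hc])]
      omega
    exact lt_of_le_of_lt ((LaurentSeries.valuation_le_iff_coeff_lt_eq_zero k).2 hf) hlt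
  · rintro ⟨D, hD⟩
    have h0 : Valued.v.restrict (HahnSeries.single (D : ℤ) (1 : k) : LaurentSeries k) ≠ 0 := by
      simp
    refine ⟨Units.mk0 _ h0, fun f hf => hD ?_⟩
    rw [Set.mem_ofPred_eq, Units.val_mk0, Valuation.restrict_lt_iff,
      LaurentSeries.valuation_single_zpow] at hf
    exact (LaurentSeries.valuation_le_iff_coeff_lt_eq_zero k).1 hf.le

/-- A Laurent series is the sum of its terms. -/
theorem LaurentSeries.hasSum_single (f : LaurentSeries k) :
    HasSum (fun n : ℤ => (HahnSeries.single n (f.coeff n) : LaurentSeries k)) f := by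
  rw [HasSum, SummationFilter.unconditional_filter, Filter.tendsto_def]
  intro s hs
  have hs' : (fun x => f + x) ⁻¹' s ∈ 𝓝 (0 : LaurentSeries k) := by
    apply (continuous_const_add f).continuousAt.preimage_mem_nhds
    simpa using hs
  obtain ⟨D, hD⟩ := LaurentSeries.mem_nhds_zero_iff.1 hs'
  filter_upwards [Filter.eventually_ge_atTop (Finset.Ico f.order (D : ℤ))] with F hF
  have hmem : (∑ n ∈ F, (HahnSeries.single n (f.coeff n) : LaurentSeries k)) - f ∈
      {g : LaurentSeries k | ∀ n : ℤ, n < D → g.coeff n = 0} := by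
    intro n hn
    rw [HahnSeries.coeff_sub, HahnSeries.coeff_sum, sub_eq_zero]
    rw [Finset.sum_eq_single n (fun m _ hm => HahnSeries.coeff_single_of_ne hm.symm),
      HahnSeries.coeff_single_same]
    intro h
    rw [HahnSeries.coeff_single_same]
    refine HahnSeries.coeff_eq_zero_of_lt_order ?_
    by_contra! hle
    exact h (hF (Finset.mem_Ico.2 ⟨hle, hn⟩))
  simpa using hD hmem

theorem LaurentSeries.exists_X_pow_mul {f : LaurentSeries k} {D : ℕ}
    (hf : ∀ n : ℤ, n < D → f.coeff n = 0) :
    ∃ g : PowerSeries k, f = ((PowerSeries.X ^ D * g : PowerSeries k) : LaurentSeries k) := by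
  have h1 : f = ((PowerSeries.mk fun m : ℕ => f.coeff m : PowerSeries k) : LaurentSeries k) := by
    ext n
    rw [PowerSeries.coeff_coe]
    split_ifs with hn
    · exact hf n (by omega)
    · rw [PowerSeries.coeff_mk]; congr 1; omega
  obtain ⟨g, hg⟩ := (PowerSeries.X_pow_dvd_iff (n := D)
    (φ := (PowerSeries.mk fun m : ℕ => f.coeff m : PowerSeries k))).2 fun m hm => by
      rw [PowerSeries.coeff_mk]; exact hf m (by omega)
  exact ⟨g, by rw [h1, hg]⟩

theorem LaurentSeries.coeff_X_pow_mul_eq_zero (D : ℕ) (g : PowerSeries k) {n : ℤ} (hn : n < D) :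
    ((PowerSeries.X ^ D * g : PowerSeries k) : LaurentSeries k).coeff n = 0 := by
  rw [PowerSeries.coeff_coe]
  split_ifs with h
  · rfl
  · rw [PowerSeries.coeff_X_pow_mul', if_neg (by omega)]

theorem X_dvd_ringEquiv_X (S : PowerSeries k ≃+* PowerSeries k) :
    (PowerSeries.X : PowerSeries k) ∣ S PowerSeries.X := by
  rw [PowerSeries.X_dvd_iff]
  by_contra h
  have h1 : IsUnit (S PowerSeries.X) := by
    rw [PowerSeries.isUnit_iff_constantCoeff]; exact (Ne.isUnit h)
  have h2 := h1.map S.symm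
  rw [S.symm_apply_apply, PowerSeries.isUnit_iff_constantCoeff] at h2
  simp at h2

/-- Continuity is automatic: S(X) is a nonunit, hence divisible by X, so S maps each ideal (X^D)
into itself. -/
theorem continuous_ringEquivOfRingEquiv (S : PowerSeries k ≃+* PowerSeries k) :
    Continuous (IsFractionRing.ringEquivOfRingEquiv S : LaurentSeries k ≃+* LaurentSeries k) := by
  refine continuous_of_continuousAt_zero
    (IsFractionRing.ringEquivOfRingEquiv S : LaurentSeries k ≃+* LaurentSeries k) ?_
  rw [ContinuousAt, map_zero, Filter.tendsto_def]
  intro s hs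
  obtain ⟨D, hD⟩ := LaurentSeries.mem_nhds_zero_iff.1 hs
  refine LaurentSeries.mem_nhds_zero_iff.2 ⟨D, fun f hf => hD ?_⟩
  obtain ⟨g, rfl⟩ := LaurentSeries.exists_X_pow_mul hf
  obtain ⟨h, hh⟩ := X_dvd_ringEquiv_X S
  intro n hn
  have := IsFractionRing.ringEquivOfRingEquiv_algebraMap (K := LaurentSeries k)
    (L := LaurentSeries k) S (PowerSeries.X ^ D * g)
  rw [LaurentSeries.coe_algebraMap] at this
  rw [this, map_mul, map_pow, hh, mul_pow, mul_assoc]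
  exact LaurentSeries.coeff_X_pow_mul_eq_zero D _ hn

/-- The series `t / (α + β t)`, that is, the inverse of `α t⁻¹ + β`. -/
noncomputable def moebius (α β : k) : PowerSeries k :=
  PowerSeries.X * (PowerSeries.C α + PowerSeries.C β * PowerSeries.X)⁻¹

theorem moebius_mul {α : k} (hα : α ≠ 0) (β : k) :
    moebius α β * (PowerSeries.C α + PowerSeries.C β * PowerSeries.X) = PowerSeries.X := by
  rw [moebius, mul_assoc, PowerSeries.inv_mul_cancel _ (by simpa using hα), mul_one]

theorem hasSubst_moebius (α β : k) : PowerSeries.HasSubst (moebius α β) :=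
  PowerSeries.HasSubst.of_constantCoeff_zero' (by simp [moebius])

/-- These parameters belong to the inverse of the affine map x ↦ α x + β; the identity makes the
substitution invertible. -/
theorem subst_moebius {α : k} (hα : α ≠ 0) (β : k) :
    (moebius α β).subst (moebius α⁻¹ (-β * α⁻¹)) = (PowerSeries.X : PowerSeries k) := by
  set s := moebius α⁻¹ (-β * α⁻¹) with hs
  have hsub := hasSubst_moebius α⁻¹ (-β * α⁻¹)
  have h1 := moebius_mul (inv_ne_zero hα) (-β * α⁻¹)
  rw [← hs] at h1 hsub
  have h2 := congrArg (PowerSeries.substAlgHom hsub) (moebius_mul hα β)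
  have hC : ∀ a : k, PowerSeries.substAlgHom hsub (PowerSeries.C a) = PowerSeries.C a := fun a => by
    simpa using (PowerSeries.substAlgHom hsub).commutes a
  rw [map_mul, map_add, map_mul, hC, hC, PowerSeries.substAlgHom_X] at h2
  have hαα : (PowerSeries.C α : PowerSeries k) * PowerSeries.C α⁻¹ = 1 := by
    rw [← map_mul, mul_inv_cancel₀ hα, map_one]
  have h3 : s = (PowerSeries.C α + PowerSeries.C β * s) * PowerSeries.X := by
    rw [map_mul, map_neg] at h1
    linear_combination (PowerSeries.C α) * h1 - (s - PowerSeries.C β * PowerSeries.X * s) * hαα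
  have hne : PowerSeries.C α + PowerSeries.C β * s ≠ 0 := by
    intro h0
    have := congrArg PowerSeries.constantCoeff h0
    simp [hs, moebius, hα] at this
  refine mul_left_cancel₀ hne ?_
  rw [← h3, ← PowerSeries.coe_substAlgHom hsub, mul_comm]
  exact h2

/-- The substitution of `α t⁻¹ + β` for `t⁻¹` in power series in `t`. -/
noncomputable def powerSeriesAffine {α : k} (hα : α ≠ 0) (β : k) :
    PowerSeries k ≃+* PowerSeries k where
  toFun f := f.subst (moebius α β)
  invFun f := f.subst (moebius α⁻¹ (-β * α⁻¹))
  left_inv f := by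
    beta_reduce
    rw [PowerSeries.subst_comp_subst_apply (hasSubst_moebius _ _) (hasSubst_moebius _ _),
      subst_moebius hα, PowerSeries.X_subst]
  right_inv f := by
    have h := subst_moebius (inv_ne_zero hα) (-β * α⁻¹)
    have hβ : -(-β * α⁻¹) * α⁻¹⁻¹ = β := by field_simp
    rw [hβ, inv_inv] at h
    beta_reduce
    rw [PowerSeries.subst_comp_subst_apply (hasSubst_moebius _ _) (hasSubst_moebius _ _), h,
      PowerSeries.X_subst]
  map_mul' := PowerSeries.subst_mul (hasSubst_moebius α β)
  map_add' := PowerSeries.subst_add (hasSubst_moebius α β)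

/-- The automorphism `f(t⁻¹) ↦ f(α t⁻¹ + β)` of `k((t))`. -/
noncomputable def laurentAffine {α : k} (hα : α ≠ 0) (β : k) : LaurentSeries k ≃+* LaurentSeries k :=
  IsFractionRing.ringEquivOfRingEquiv (powerSeriesAffine hα β)

theorem laurentAffine_coe {α : k} (hα : α ≠ 0) (β : k) (f : PowerSeries k) :
    laurentAffine hα β (f : LaurentSeries k) = (f.subst (moebius α β) : PowerSeries k) := by
  have := IsFractionRing.ringEquivOfRingEquiv_algebraMap (K := LaurentSeries k)
    (L := LaurentSeries k) (powerSeriesAffine hα β) f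
  rw [LaurentSeries.coe_algebraMap] at this
  exact this

theorem laurentAffine_C {α : k} (hα : α ≠ 0) (β a : k) :
    laurentAffine hα β (HahnSeries.C a) = HahnSeries.C a := by
  rw [← PowerSeries.coe_C, laurentAffine_coe, PowerSeries.subst_C]; rfl

theorem laurentAffine_tInv {α : k} (hα : α ≠ 0) (β : k) :
    laurentAffine hα β (UnipotentG2.tInv k) =
      HahnSeries.C α * UnipotentG2.tInv k + HahnSeries.C β := by
  have hX : ((PowerSeries.X : PowerSeries k) : LaurentSeries k) * UnipotentG2.tInv k = 1 := by
    rw [PowerSeries.coe_X, UnipotentG2.tInv, HahnSeries.single_mul_single]; simp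
  have h1 := congrArg (laurentAffine hα β) hX
  rw [map_mul, map_one, laurentAffine_coe, PowerSeries.subst_X (hasSubst_moebius α β)] at h1
  have h2 := congrArg (fun f : PowerSeries k => (f : LaurentSeries k)) (moebius_mul hα β)
  simp only [PowerSeries.coe_mul, PowerSeries.coe_add, PowerSeries.coe_C] at h2
  refine mul_left_cancel₀ (left_ne_zero_of_mul_eq_one h1) ?_
  rw [h1]
  linear_combination (-1 + (moebius α β : LaurentSeries k) * HahnSeries.C β) * hX -
    UnipotentG2.tInv k * h2

/-- Apply the continuous automorphism term by term to the expansion of f. -/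
theorem laurentAffine_hasSum {α : k} (hα : α ≠ 0) (β : k) (f : LaurentSeries k) :
    UnipotentG2.IsAffineSubst α β f (laurentAffine hα β f) := by
  have := (LaurentSeries.hasSum_single f).map (laurentAffine hα β)
    (continuous_ringEquivOfRingEquiv _)
  unfold UnipotentG2.IsAffineSubst
  convert this using 1
  ext1 n
  rw [Function.comp_apply, ← laurentAffine_tInv hα β, ← laurentAffine_C hα β (f.coeff n),
    ← map_zpow₀, ← map_mul]
  have hinv : UnipotentG2.tInv k = (HahnSeries.single (1 : ℤ) (1 : k))⁻¹ := by
    rw [UnipotentG2.tInv, HahnSeries.inv_single]; simp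
  rw [hinv, inv_zpow, zpow_neg, inv_inv, ← RatFunc.single_zpow, HahnSeries.C_apply,
    HahnSeries.single_mul_single, zero_add, mul_one]

/-- The automorphism of `k((t))` given by an automorphism of the field of coefficients. -/
noncomputable def laurentMap (σ : k ≃+* k) : LaurentSeries k ≃+* LaurentSeries k where
  toFun f := HahnSeries.map f σ
  invFun f := HahnSeries.map f σ.symm
  left_inv f := by ext; simp
  right_inv f := by ext; simp
  map_mul' f g := HahnSeries.map_mul (σ : k →ₙ+* k)
  map_add' f g := HahnSeries.map_add (σ : k →+ k)

theorem continuous_laurentMap (σ : k ≃+* k) : Continuous (laurentMap σ) := by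
  refine continuous_of_continuousAt_zero (laurentMap σ) ?_
  rw [ContinuousAt, map_zero, Filter.tendsto_def]
  intro s hs
  obtain ⟨D, hD⟩ := LaurentSeries.mem_nhds_zero_iff.1 hs
  refine LaurentSeries.mem_nhds_zero_iff.2 ⟨D, fun f hf => hD ?_⟩
  intro n hn
  change σ (f.coeff n) = 0
  rw [hf n hn, map_zero]

theorem laurentMap_tInv (σ : k ≃+* k) :
    laurentMap σ (UnipotentG2.tInv k) = UnipotentG2.tInv k := by
  ext n
  change σ ((UnipotentG2.tInv k).coeff n) = _
  rcases eq_or_ne n (-1) with rfl | hn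
  · simp [UnipotentG2.tInv]
  · simp [UnipotentG2.tInv, HahnSeries.coeff_single_of_ne hn]

theorem laurentMap_C (σ : k ≃+* k) (a : k) :
    laurentMap σ (HahnSeries.C a) = HahnSeries.C (σ a) := by
  ext n
  change σ ((HahnSeries.C a : LaurentSeries k).coeff n) = _
  rcases eq_or_ne n 0 with rfl | hn
  · simp
  · simp [HahnSeries.C_apply, HahnSeries.coeff_single_of_ne hn]

/-- The embedding `f ↦ f(t⁻¹)` of `k[X]` in `k((t))`. -/
noncomputable def evalInv (k : Type*) [Field k] : k[X] →ₐ[k] LaurentSeries k :=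
  aeval (UnipotentG2.tInv k)

theorem evalInv_C (a : k) : evalInv k (C a) = HahnSeries.C a := by
  rw [evalInv, aeval_C, LaurentSeries.algebraMap_apply]

theorem evalInv_X : evalInv k X = UnipotentG2.tInv k := by
  rw [evalInv, aeval_X]

theorem evalInv_injective : Function.Injective (evalInv k) := by
  rw [injective_iff_map_eq_zero]
  intro f hf
  ext n
  have hpow : ∀ m : ℕ, UnipotentG2.tInv k ^ m = HahnSeries.single (-(m : ℤ)) 1 := fun m => by
    rw [UnipotentG2.tInv, HahnSeries.single_pow]; simp
  have h := congrArg (fun g : LaurentSeries k => g.coeff (-(n : ℤ))) hf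
  rw [evalInv, aeval_eq_sum_range' (Nat.lt_succ_of_le (le_max_left f.natDegree n))] at h
  simp only [HahnSeries.coeff_sum, hpow, Algebra.smul_def, LaurentSeries.algebraMap_apply,
    HahnSeries.C_apply, HahnSeries.single_mul_single, zero_add, mul_one, HahnSeries.coeff_zero] at h
  rw [Finset.sum_eq_single n] at h
  · simpa using h
  · intro m _ hm
    rw [HahnSeries.coeff_single_of_ne (by simpa using hm.symm)]
  · intro hn
    exact absurd (Finset.mem_range.2 (Nat.lt_succ_of_le (le_max_right f.natDegree n))) hn

/-- Every ring automorphism of `k[t⁻¹]` extends to an affine twist of `k((t))`. -/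
theorem exists_isAffineTwist (p : ℕ) [Fact p.Prime] [Algebra (ZMod p) k] [Finite k]
    (T : k[X] ≃+* k[X]) : ∃ τ : LaurentSeries k ≃+* LaurentSeries k,
      UnipotentG2.IsAffineTwist p τ ∧ ∀ f, τ (evalInv k f) = evalInv k (T f) := by
  obtain ⟨σ, α, β, hα, hT⟩ := exists_affine_of_ringEquiv T
  refine ⟨(laurentAffine hα β).trans (laurentMap σ), ⟨?_, ?_⟩, ?_⟩
  · exact (continuous_laurentMap σ).comp (continuous_ringEquivOfRingEquiv _)
  · refine ⟨AlgEquiv.ofRingEquiv (f := σ) fun x => ?_, α, β, hα, fun f =>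
      ⟨laurentAffine hα β f, laurentAffine_hasSum hα β f, rfl⟩⟩
    -- A field automorphism is 𝔽_p-linear because ring homomorphisms out of `ZMod p` are unique.
    exact RingHom.congr_fun (Subsingleton.elim ((σ : k →+* k).comp (algebraMap (ZMod p) k))
      (algebraMap (ZMod p) k)) x
  · intro f
    rw [hT]
    induction f using Polynomial.induction_on' with
    | add f g hf hg => simp only [map_add, add_comp, Polynomial.map_add, hf, hg]
    | monomial n a =>
      rw [← C_mul_X_pow_eq_monomial]
      simp only [mul_comp, pow_comp, C_comp, X_comp, Polynomial.map_mul, Polynomial.map_pow,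
        Polynomial.map_add, Polynomial.map_C, Polynomial.map_X, map_mul, map_pow, map_add,
        evalInv_C, evalInv_X, RingEquiv.trans_apply, laurentAffine_C, laurentAffine_tInv,
        laurentMap_C, laurentMap_tInv]
      rfl

theorem mem_Fminus_iff {x : LaurentSeries k} : x ∈ UnipotentG2.Fminus k ↔ ∃ f, evalInv k f = x := by
  rw [UnipotentG2.Fminus, Algebra.adjoin_singleton_eq_range_aeval]; rfl

end Laurent

end FrobeniusBracket

/-! ### Coordinates, commutators and integral points of G₂ -/

namespace UnipotentG2

open FrobeniusBracket

variable {p : ℕ} [Fact p.Prime] {r : ℕ} {k : Type*} [Field k] [Algebra (ZMod p) k]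

theorem ycoord_mul (g h : G2 p r k) : ycoord (g * h) = ycoord g + ycoord h := by
  rw [← mk_coords g, ← mk_coords h, mk_mul_mk]; simp

theorem zcoord_mul (g h : G2 p r k) :
    zcoord (g * h) = zcoord g + zcoord h + ycoord g ^ p ^ r * ycoord h := by
  rw [← mk_coords g, ← mk_coords h, mk_mul_mk]; simp

theorem mk_zero_zero : (mk 0 0 : G2 p r k) = 1 := by
  have h : (mk 0 0 : G2 p r k) * mk 0 0 = mk 0 0 := by
    rw [mk_mul_mk]; simp
  exact mul_eq_left.1 h

theorem inv_mk (y z : LaurentSeries k) :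
    (mk y z : G2 p r k)⁻¹ = mk (-y) (-z + y ^ p ^ r * y) := by
  rw [inv_eq_iff_mul_eq_one, mk_mul_mk, ← mk_zero_zero]
  congr 1 <;> ring

theorem ycoord_one : ycoord (1 : G2 p r k) = 0 := by
  rw [← mk_zero_zero, ycoord_mk]

theorem ycoord_inv (g : G2 p r k) : ycoord g⁻¹ = -ycoord g := by
  rw [← mk_coords g, inv_mk]; simp

theorem zcoord_inv (g : G2 p r k) : zcoord g⁻¹ = -zcoord g + ycoord g ^ p ^ r * ycoord g := by
  rw [← mk_coords g, inv_mk]; simp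

theorem commute_of_ycoord_eq_zero {g : G2 p r k} (hg : ycoord g = 0) (h : G2 p r k) :
    g * h = h * g := by
  apply ext'
  · rw [ycoord_mul, ycoord_mul, add_comm]
  · have hp : p ^ r ≠ 0 := pow_ne p r
    rw [zcoord_mul, zcoord_mul, hg, zero_pow hp]; ring

/-- This identifies the bracket with the commutator of G₂, the source of all constraints on λ. -/
theorem mul_eq_mk_bracket_mul (g h : G2 p r k) :
    g * h = mk 0 (bracket (p ^ r) (ycoord g) (ycoord h)) * (h * g) := by
  apply ext'
  · simp only [ycoord_mul, ycoord_mk]; ring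
  · have hp : p ^ r ≠ 0 := pow_ne p r
    simp only [zcoord_mul, ycoord_mk, zcoord_mk, zero_pow hp, bracket]; ring

theorem bracket_eq_zero_of_commute {g h : G2 p r k} (hc : g * h = h * g) :
    bracket (p ^ r) (ycoord g) (ycoord h) = 0 := by
  have h1 := mul_eq_mk_bracket_mul g h
  rw [hc, eq_comm, mul_eq_right] at h1
  have := congrArg zcoord h1
  rwa [zcoord_mk, ← mk_zero_zero, zcoord_mk] at this

variable (p r k) in
/-- The subgroup of `G₂` of the matrices with entries in `k[t⁻¹]`. -/
noncomputable def integral : Subgroup (G2 p r k) := (GLminus k 3).subgroupOf (G2 p r k)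

theorem mem_integral_iff {g : G2 p r k} : g ∈ integral p r k ↔
    (∃ f, evalInv k f = ycoord g) ∧ ∃ f, evalInv k f = zcoord g := by
  constructor
  · intro hg
    obtain ⟨M, hM⟩ := Subgroup.mem_subgroupOf.1 hg
    have h (i j) : (M i j : LaurentSeries k) =
        (g.1 : Matrix (Fin 3) (Fin 3) (LaurentSeries k)) i j := by
      rw [← hM]; rfl
    refine ⟨mem_Fminus_iff.1 ?_, mem_Fminus_iff.1 ?_⟩
    · rw [ycoord, ← h]; exact (M 1 2).2
    · rw [zcoord, ← h]; exact (M 0 2).2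
  · rintro ⟨hy, hz⟩
    have := charP_laurent p k
    have hchar : CharP (Fminus k) p :=
      RingHom.charP (Fminus k).val.toRingHom Subtype.val_injective p
    let y : Fminus k := ⟨ycoord g, mem_Fminus_iff.2 hy⟩
    let z : Fminus k := ⟨zcoord g, mem_Fminus_iff.2 hz⟩
    have hmul : mat (p ^ r) y z * mat (p ^ r) (-y) (-z + y ^ p ^ r * y) = 1 := by
      rw [mat_mul, ← mat_zero (pow_ne p r)]
      congr 1 <;> ring
    refine Subgroup.mem_subgroupOf.2 ⟨⟨_, _, hmul, mul_eq_one_comm.mp hmul⟩, Units.ext ?_⟩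
    rw [← mk_coords g]
    ext i j : 2
    fin_cases i <;> fin_cases j <;> simp [mk, matUnit, mat, y, z]

/-! ### From two arithmetic embeddings to a bracket correspondence -/

section Correspondence

variable {S : Type*} [Group S] (j₁ j₂ : S →* G2 p r k)

/-- The relation between the `y`-coordinates under `j₁` and `j₂`. -/
def yGraph : AddSubgroup (k[X] × k[X]) where
  carrier := {x | ∃ s, ycoord (j₁ s) = evalInv k x.1 ∧ ycoord (j₂ s) = evalInv k x.2}
  add_mem' := by
    rintro x y ⟨s, h₁, h₂⟩ ⟨t, h₁', h₂'⟩
    refine ⟨s * t, ?_, ?_⟩ <;> simp [ycoord_mul, *]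
  zero_mem' := ⟨1, by simp [ycoord_one], by simp [ycoord_one]⟩
  neg_mem' := by
    rintro x ⟨s, h₁, h₂⟩
    refine ⟨s⁻¹, ?_, ?_⟩ <;> simp [ycoord_inv, *]

/-- The relation between the central elements under `j₁` and `j₂`. -/
def zGraph : AddSubgroup (k[X] × k[X]) where
  carrier := {x | ∃ s, j₁ s = mk 0 (evalInv k x.1) ∧ j₂ s = mk 0 (evalInv k x.2)}
  add_mem' := by
    rintro x y ⟨s, h₁, h₂⟩ ⟨t, h₁', h₂'⟩
    refine ⟨s * t, ?_, ?_⟩ <;> simp [mk_mul_mk, *]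
  zero_mem' := ⟨1, by simp [mk_zero_zero], by simp [mk_zero_zero]⟩
  neg_mem' := by
    rintro x ⟨s, h₁, h₂⟩
    refine ⟨s⁻¹, ?_, ?_⟩ <;> simp [inv_mk, *]

variable {j₁ j₂}

theorem swapSubgroup_yGraph : swapSubgroup (yGraph j₁ j₂) = yGraph j₂ j₁ := by
  ext ⟨a, b⟩
  exact exists_congr fun s => and_comm

theorem swapSubgroup_zGraph : swapSubgroup (zGraph j₁ j₂) = zGraph j₂ j₁ := by
  ext ⟨a, b⟩
  exact exists_congr fun s => and_comm

variable (j₁ j₂) in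
/-- The elements whose images under `j₁` and `j₂` are integral. -/
noncomputable def biIntegral : Subgroup S := (integral p r k).comap j₁ ⊓ (integral p r k).comap j₂

theorem finiteIndex_biIntegral (h₁ : (integral p r k).relIndex j₁.range ≠ 0)
    (h₂ : (integral p r k).relIndex j₂.range ≠ 0) : (biIntegral j₁ j₂).FiniteIndex := by
  rw [Subgroup.finiteIndex_iff]
  refine Subgroup.index_inf_ne_zero ?_ ?_
  · rwa [Subgroup.index_comap]
  · rwa [Subgroup.index_comap]

variable (p r k) in
/-- The coordinate `y` as a group homomorphism. -/
noncomputable def yHom : G2 p r k →* Multiplicative (LaurentSeries k) where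
  toFun g := Multiplicative.ofAdd (ycoord g)
  map_one' := by rw [ycoord_one]; rfl
  map_mul' g h := by rw [ycoord_mul]; rfl

/-- The elements integral under both embeddings have an image under j₁ of nonzero relative index in
the integral group, whose y-coordinates fill k[t⁻¹]. -/
theorem finiteIndex_yGraph_fst (h₁ : Subgroup.Commensurable j₁.range (integral p r k))
    (h₂ : Subgroup.Commensurable j₂.range (integral p r k)) :
    ((yGraph j₁ j₂).map (AddMonoidHom.fst _ _)).FiniteIndex := by
  have hU := finiteIndex_biIntegral h₁.2 h₂.2
  have hrel : ((biIntegral j₁ j₂).map j₁).relIndex (integral p r k) ≠ 0 := by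
    refine Subgroup.relIndex_ne_zero_trans (K := j₁.range) ?_ h₁.1
    rw [MonoidHom.range_eq_map, ← Subgroup.relIndex_comap]
    rw [Subgroup.relIndex_top_right]
    exact fun h0 => hU.index_ne_zero (Nat.eq_zero_of_zero_dvd
      (h0 ▸ Subgroup.index_dvd_of_le (Subgroup.le_comap_map j₁ (biIntegral j₁ j₂))))
  let i : Multiplicative k[X] →* Multiplicative (LaurentSeries k) :=
    AddMonoidHom.toMultiplicative (evalInv k : k[X] →+ LaurentSeries k)
  have hi : i.range ≤ (integral p r k).map (yHom p r k) := by
    rintro _ ⟨f, rfl⟩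
    exact ⟨mk (evalInv k f.toAdd) 0, mem_integral_iff.2 ⟨⟨f.toAdd, by simp⟩, ⟨0, by simp⟩⟩,
      by simp [yHom, i]⟩
  rw [← AddSubgroup.finiteIndex_toSubgroup_iff]
  have hK : ((((biIntegral j₁ j₂).map j₁).map (yHom p r k)).comap i).FiniteIndex := by
    rw [Subgroup.finiteIndex_iff, Subgroup.index_comap]
    intro h0
    refine absurd (Subgroup.relIndex_eq_zero_of_le_right hi h0) ?_
    rw [← Subgroup.relIndex_comap]
    exact fun h0 => hrel (Subgroup.relIndex_eq_zero_of_le_left (Subgroup.le_comap_map _ _) h0)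
  refine Subgroup.finiteIndex_of_le (H := (((biIntegral j₁ j₂).map j₁).map (yHom p r k)).comap i) ?_
  rintro f ⟨_, ⟨s, hs, rfl⟩, hf⟩
  obtain ⟨f', hf'⟩ := (mem_integral_iff.1 hs.2).1
  exact ⟨(f.toAdd, f'), ⟨s, Multiplicative.ofAdd.injective hf, hf'.symm⟩, rfl⟩

/-- The two terms of the bracket have different degrees. -/
theorem bracket_ne_zero_of_natDegree_lt {e : ℕ} (he : 1 < e) {u v : k[X]} (hu : u ≠ 0)
    (h : u.natDegree < v.natDegree) : bracket e u v ≠ 0 := by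
  have hv : v ≠ 0 := by rintro rfl; simp at h
  intro h0
  have := congrArg natDegree (sub_eq_zero.1 h0)
  rw [natDegree_mul (pow_ne_zero _ hu) hv, natDegree_mul hu (pow_ne_zero _ hv), natDegree_pow,
    natDegree_pow] at this
  nlinarith

theorem snd_eq_zero_of_mem_zGraph (hj : Function.Injective j₁) {v : k[X]}
    (h : (0, v) ∈ zGraph j₁ j₂) : v = 0 := by
  obtain ⟨s, hs₁, hs₂⟩ := h
  have hs : s = 1 := hj (by rw [hs₁, map_one]; simpa using mk_zero_zero)
  rw [hs, map_one, ← mk_zero_zero] at hs₂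
  have := congrArg zcoord hs₂
  rw [zcoord_mk, zcoord_mk] at this
  exact (map_eq_zero_iff _ evalInv_injective).1 this.symm

theorem bracket_mem_zGraph {u u' v v' : k[X]} (hu : (u, u') ∈ yGraph j₁ j₂)
    (hv : (v, v') ∈ yGraph j₁ j₂) :
    (bracket (p ^ r) u v, bracket (p ^ r) u' v') ∈ zGraph j₁ j₂ := by
  obtain ⟨s, hs₁, hs₂⟩ := hu
  obtain ⟨t, ht₁, ht₂⟩ := hv
  refine ⟨s * t * (t * s)⁻¹, ?_, ?_⟩
  · rw [map_mul, map_mul, mul_eq_mk_bracket_mul (j₁ s), ← map_mul, map_inv, mul_inv_cancel_right,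
      hs₁, ht₁]
    simp [bracket]
  · rw [map_mul, map_mul, mul_eq_mk_bracket_mul (j₂ s), ← map_mul, map_inv, mul_inv_cancel_right,
      hs₂, ht₂]
    simp [bracket]

variable [Finite k]

/-- An element with y = 0 under j₁ is central in S, so its image under j₂ commutes with all of
j₂(S). If v were nonzero, an element of larger degree there would have nonzero bracket with it. -/
theorem snd_eq_zero_of_mem_yGraph (he : 2 < p ^ r) (hj : Function.Injective j₁)
    (h₁ : Subgroup.Commensurable j₁.range (integral p r k))
    (h₂ : Subgroup.Commensurable j₂.range (integral p r k)) {v : k[X]}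
    (h : (0, v) ∈ yGraph j₁ j₂) : v = 0 := by
  obtain ⟨s, hs₁, hs₂⟩ := h
  by_contra hv
  have := finiteIndex_yGraph_fst h₂ h₁
  obtain ⟨_, ⟨⟨w, w'⟩, ⟨t, ht₂, -⟩, rfl⟩, hdeg⟩ := exists_mem_natDegree_gt
    ((yGraph j₂ j₁).map (AddMonoidHom.fst _ _)) v.natDegree
  have hst : s * t = t * s := hj (by
    rw [map_mul, map_mul]
    exact commute_of_ycoord_eq_zero (by simpa using hs₁) _)
  have h0 := bracket_eq_zero_of_commute (g := j₂ s) (h := j₂ t) (by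
    rw [← map_mul, hst, map_mul])
  rw [hs₂, ht₂] at h0
  refine bracket_ne_zero_of_natDegree_lt (by omega) hv hdeg
    (evalInv_injective (k := k) ?_ : bracket (p ^ r) v w = 0)
  simpa [bracket] using h0

variable (j₁ j₂) in
/-- Two embeddings of a group as arithmetic subgroups of `G₂` give a bracket correspondence. -/
noncomputable def bracketCorrespondence (he : 2 < p ^ r) (hj₁ : Function.Injective j₁)
    (hj₂ : Function.Injective j₂) (h₁ : Subgroup.Commensurable j₁.range (integral p r k))
    (h₂ : Subgroup.Commensurable j₂.range (integral p r k)) :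
    BracketCorrespondence k (p ^ r) where
  graph := yGraph j₁ j₂
  bracketGraph := zGraph j₁ j₂
  snd_eq_zero h := snd_eq_zero_of_mem_yGraph he hj₁ h₁ h₂ h
  fst_eq_zero h := snd_eq_zero_of_mem_yGraph he hj₂ h₂ h₁
    (swapSubgroup_yGraph (j₁ := j₁) (j₂ := j₂) ▸ mem_swapSubgroup.2 h)
  bracket_snd_eq_zero h := snd_eq_zero_of_mem_zGraph hj₁ h
  bracket_fst_eq_zero h := snd_eq_zero_of_mem_zGraph hj₂
    (swapSubgroup_zGraph (j₁ := j₁) (j₂ := j₂) ▸ mem_swapSubgroup.2 h)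
  finiteIndex_fst := finiteIndex_yGraph_fst h₁ h₂
  finiteIndex_snd := by
    rw [← map_fst_swapSubgroup, swapSubgroup_yGraph]
    exact finiteIndex_yGraph_fst h₂ h₁
  bracket_mem := bracket_mem_zGraph

variable (j₁ j₂) in
/-- Two embeddings of a group as arithmetic subgroups of `G₂` differ, on the `y`-coordinates of a
finite-index subgroup, by a twist of `k[t⁻¹]` and a rational factor. -/
theorem exists_twist (he : 2 < p ^ r) (hj₁ : Function.Injective j₁)
    (hj₂ : Function.Injective j₂) (h₁ : Subgroup.Commensurable j₁.range (integral p r k))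
    (h₂ : Subgroup.Commensurable j₂.range (integral p r k)) :
    ∃ (T : k[X] ≃+* k[X]) (u v : k[X]), u ≠ 0 ∧ v ≠ 0 ∧
      ∀ s ∈ biIntegral j₁ j₂, ∃ f, ycoord (j₁ s) = evalInv k f ∧
        ycoord (j₂ s) = evalInv k v / evalInv k (T u) * evalInv k (T f) := by
  have : CharP k p := charP_of_injective_algebraMap (algebraMap (ZMod p) k).injective p
  let Φ := bracketCorrespondence j₁ j₂ he hj₁ hj₂ h₁ h₂
  obtain ⟨u, hu, hu0⟩ := exists_mem_ne_zero Φ.dom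
  obtain ⟨v, hv⟩ := Φ.mem_dom.1 hu
  refine ⟨Φ.twistEquiv he, u, v, hu0, BracketCorrespondence.snd_ne_zero hu0 hv, fun s hs => ?_⟩
  obtain ⟨f, hf⟩ := (mem_integral_iff.1 hs.1).1
  obtain ⟨g, hg⟩ := (mem_integral_iff.1 hs.2).1
  have hfg : (f, g) ∈ Φ.graph := ⟨s, hf.symm, hg.symm⟩
  refine ⟨f, hf.symm, ?_⟩
  have h1 := congrArg (evalInv k) (BracketCorrespondence.mul_twist_eq he hfg hv)
  rw [map_mul, map_mul] at h1
  have h2 : evalInv k (Φ.twistEquiv he u) ≠ 0 := by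
    rw [map_ne_zero_iff _ evalInv_injective]; simpa using hu0
  rw [← hg, div_mul_eq_mul_div, eq_div_iff h2]
  exact h1

end Correspondence

/-! ### Commensurability and the central factor -/

section Commensurability

variable [Finite k]

theorem finiteIndex_of_finite_fibers {G X : Type*} [Group G] [Finite X] (H : Subgroup G) (f : G → X)
    (hf : ∀ g h, f g = f h → g⁻¹ * h ∈ H) : H.FiniteIndex := by
  rw [Subgroup.finiteIndex_iff_finite_quotient]
  refine Finite.of_injective (fun x : G ⧸ H => f x.out) fun x y hxy => ?_
  rw [← QuotientGroup.out_eq' x, ← QuotientGroup.out_eq' y]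
  exact QuotientGroup.eq.2 (hf _ _ hxy)

/-- A standard automorphism commensurates the integral subgroup. -/
theorem relIndex_comap_phi_ne_zero {τ : LaurentSeries k ≃+* LaurentSeries k} {T : k[X] ≃+* k[X]}
    (hT : ∀ f, τ (evalInv k f) = evalInv k (T f)) {u v : k[X]} (hu : u ≠ 0)
    (ha : evalInv k v / evalInv k (T u) ≠ 0) :
    ((integral p r k).comap (phi τ _ ha : G2 p r k ≃* G2 p r k).toMonoidHom).relIndex
      (integral p r k) ≠ 0 := by
  rw [Subgroup.relIndex, ← Subgroup.finiteIndex_iff]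
  set N := u ^ (p ^ r + 1) with hN
  have hR := finiteIndex_map_mulLeft (⊤ : AddSubgroup k[X]) (pow_ne_zero (p ^ r + 1) hu)
  rw [← hN] at hR
  set R := (⊤ : AddSubgroup k[X]).map (AddMonoidHom.mulLeft N) with hRdef
  -- If g and h have the same coordinates modulo N = u^(e+1), both coordinates of g⁻¹h are divisible
  -- by N. Then T(N) clears the denominators T(u) of a and T(u)^(e+1) of a^(e+1).
  have : Finite (k[X] ⧸ R) := AddSubgroup.finiteIndex_iff_finite_quotient.1 hR
  choose y hy using fun g : integral p r k => (mem_integral_iff.1 g.2).1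
  choose z hz using fun g : integral p r k => (mem_integral_iff.1 g.2).2
  refine finiteIndex_of_finite_fibers _ (fun g : integral p r k =>
    ((QuotientAddGroup.mk (y g), QuotientAddGroup.mk (z g)) : (k[X] ⧸ R) × (k[X] ⧸ R))) ?_
  intro g h hgh
  obtain ⟨hgy, hgz⟩ := Prod.ext_iff.1 hgh
  obtain ⟨m, -, hm⟩ := QuotientAddGroup.eq.1 hgy
  obtain ⟨n, -, hn⟩ := QuotientAddGroup.eq.1 hgz
  simp only [AddMonoidHom.coe_mulLeft] at hm hn
  have hTu : evalInv k (T u) ≠ 0 := by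
    rw [map_ne_zero_iff _ evalInv_injective]; simpa using hu
  have hyc : ycoord ((g⁻¹ * h : integral p r k) : G2 p r k) = evalInv k (N * m) := by
    rw [hm, Subgroup.coe_mul, Subgroup.coe_inv, ycoord_mul, ycoord_inv, map_add, map_neg, hy, hy]
  have hzc : zcoord ((g⁻¹ * h : integral p r k) : G2 p r k) =
      evalInv k (N * (n - y g ^ p ^ r * m)) := by
    have hneg : (-ycoord (g : G2 p r k)) ^ p ^ r = -ycoord (g : G2 p r k) ^ p ^ r := by
      have := charP_laurent p k
      have := map_neg (iterateFrobenius (LaurentSeries k) p r) (ycoord (g : G2 p r k))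
      simpa [iterateFrobenius_def] using this
    have hx : N * (n - y g ^ p ^ r * m) = -z g + z h - y g ^ p ^ r * (-y g + y h) := by
      linear_combination hn - y g ^ p ^ r * hm
    rw [hx, Subgroup.coe_mul, Subgroup.coe_inv, zcoord_mul, zcoord_inv, ycoord_inv, hneg]
    simp only [map_add, map_neg, map_sub, map_mul, map_pow, hy, hz]
    ring
  refine Subgroup.mem_subgroupOf.2 (Subgroup.mem_comap.2 (mem_integral_iff.2 ⟨?_, ?_⟩))
  · refine ⟨v * T u ^ p ^ r * T m, ?_⟩
    change _ = ycoord (mk _ _)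
    rw [ycoord_mk, hyc, hT, hN]
    simp only [map_mul, map_pow]
    field_simp
    ring
  · refine ⟨v ^ (p ^ r + 1) * T (n - y g ^ p ^ r * m), ?_⟩
    change _ = zcoord (mk _ _)
    rw [zcoord_mk, hzc, hT, hN, map_mul, map_mul T, map_mul (evalInv k), map_pow, map_pow T,
      map_pow (evalInv k), div_pow, ← mul_assoc, div_mul_cancel₀ _ (pow_ne_zero _ hTu)]

theorem commensurable_map_subtype {G : Type*} [Group G] {H : Subgroup G} (K : Subgroup H)
    (hK : K.FiniteIndex) : Subgroup.Commensurable (K.map H.subtype) H := by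
  constructor
  · have h : (K.map H.subtype).relIndex H = K.index := by
      rw [Subgroup.relIndex, Subgroup.subgroupOf, Subgroup.comap_map_eq_self_of_injective
        H.subtype_injective]
    rw [h]; exact hK.index_ne_zero
  · have h : H.relIndex (K.map H.subtype) = 1 :=
      Subgroup.relIndex_eq_one.2 (Subgroup.map_subtype_le K)
    rw [h]; exact one_ne_zero

/-- Two homomorphisms which agree modulo the centre differ by a homomorphism to the centre. -/
def centralQuotient {G H : Type*} [Group G] [Group H] (A B : G →* H)
    (h : ∀ g, (A g)⁻¹ * B g ∈ Subgroup.center H) : G →* Subgroup.center H where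
  toFun g := ⟨(A g)⁻¹ * B g, h g⟩
  map_one' := by ext; simp
  map_mul' g g' := by
    ext
    have := Subgroup.mem_center_iff.1 (h g) (A g')⁻¹
    simp only [map_mul, Subgroup.coe_mul, mul_inv_rev]
    calc (A g')⁻¹ * (A g)⁻¹ * (B g * B g') = (A g')⁻¹ * ((A g)⁻¹ * B g) * B g' := by group
      _ = _ := by rw [this]; group

end Commensurability

/-- A virtual automorphism is, on a finite-index subgroup, the product of a standard automorphism
and a homomorphism to the centre. -/
theorem exists_standard_mul_central (p : ℕ) [Fact p.Prime] (r : ℕ) (hr : 2 < p ^ r)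
    (k : Type*) [Field k] [Finite k] [Algebra (ZMod p) k]
    (Γ : Subgroup (UnipotentG2.G2 p r k))
    (hΓ : UnipotentG2.IsArithmetic (UnipotentG2.G2 p r k) Γ)
    (lam : VirtualAut Γ) :
    ∃ (τ : LaurentSeries k ≃+* LaurentSeries k) (a : LaurentSeries k) (ha : a ≠ 0),
      UnipotentG2.IsStandard p τ a ∧
      ∃ (Γ' : Subgroup Γ) (hle : Γ' ≤ lam.source) (ζ : Γ' →* Subgroup.center Γ),
        Γ'.FiniteIndex ∧
        ∀ γ : Γ',
          (((lam.toMulEquiv ⟨γ.1, hle γ.2⟩ : lam.target) : Γ) : UnipotentG2.G2 p r k) =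
            UnipotentG2.phi τ a ha (γ.1 : UnipotentG2.G2 p r k) *
              ((ζ γ : Γ) : UnipotentG2.G2 p r k) := by
  let j₁ : lam.source →* G2 p r k := Γ.subtype.comp lam.source.subtype
  let j₂ : lam.source →* G2 p r k :=
    Γ.subtype.comp (lam.target.subtype.comp lam.toMulEquiv.toMonoidHom)
  have hj₁ : Function.Injective j₁ := Γ.subtype_injective.comp lam.source.subtype_injective
  have hj₂ : Function.Injective j₂ := Γ.subtype_injective.comp
    (lam.target.subtype_injective.comp lam.toMulEquiv.injective)
  have hΓ' : Subgroup.Commensurable Γ (integral p r k) := hΓ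
  have h₁ : Subgroup.Commensurable j₁.range (integral p r k) := by
    have : j₁.range = lam.source.map Γ.subtype := by
      rw [MonoidHom.range_comp, Subgroup.range_subtype]
    rw [this]
    exact (commensurable_map_subtype _ lam.source_finiteIndex).trans hΓ'
  have h₂ : Subgroup.Commensurable j₂.range (integral p r k) := by
    have : j₂.range = lam.target.map Γ.subtype := by
      rw [MonoidHom.range_comp, MonoidHom.range_comp,
        MonoidHom.range_eq_top.2 lam.toMulEquiv.surjective, ← MonoidHom.range_eq_map,
        Subgroup.range_subtype]
    rw [this]
    exact (commensurable_map_subtype _ lam.target_finiteIndex).trans hΓ'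
  obtain ⟨T, u, v, hu, hv, hys⟩ := exists_twist j₁ j₂ hr hj₁ hj₂ h₁ h₂
  obtain ⟨τ, hτ, hτT⟩ := exists_isAffineTwist p T
  have hTu : evalInv k (T u) ≠ 0 := by
    rw [map_ne_zero_iff _ evalInv_injective]; simpa using hu
  have hv' : evalInv k v ≠ 0 := by rwa [map_ne_zero_iff _ evalInv_injective]
  have ha : evalInv k v / evalInv k (T u) ≠ 0 := div_ne_zero hv' hTu
  -- The denominator of a serves as b.
  refine ⟨τ, evalInv k v / evalInv k (T u), ha, ⟨hτ, evalInv k (T u), mem_Fminus_iff.2 ⟨_, rfl⟩,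
    hTu, mem_Fminus_iff.2 ⟨v, by rw [div_mul_cancel₀ _ hTu]⟩⟩, ?_⟩
  set φ := phi (p := p) (r := r) τ (evalInv k v / evalInv k (T u)) ha with hφ
  -- The second factor ensures φ(γ) ∈ Γ, so that ζ has values in Γ and not merely in G₂.
  let Γ' : Subgroup Γ := (biIntegral j₁ j₂).map lam.source.subtype ⊓
    (Γ.comap φ.toMonoidHom).subgroupOf Γ
  have hle : Γ' ≤ lam.source := inf_le_left.trans (Subgroup.map_subtype_le _)
  have hbi : ∀ γ : Γ', (⟨γ.1, hle γ.2⟩ : lam.source) ∈ biIntegral j₁ j₂ := by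
    intro γ
    obtain ⟨s, hs, hsγ⟩ := γ.2.1
    have : s = ⟨γ.1, hle γ.2⟩ := Subtype.ext hsγ
    exact this ▸ hs
  let A : Γ' →* Γ := (φ.toMonoidHom.comp (Γ.subtype.comp Γ'.subtype)).codRestrict Γ
    fun γ => γ.2.2
  let B : Γ' →* Γ :=
    (lam.target.subtype.comp lam.toMulEquiv.toMonoidHom).comp (Subgroup.inclusion hle)
  have hcent : ∀ γ, (A γ)⁻¹ * B γ ∈ Subgroup.center Γ := by
    intro γ
    obtain ⟨f, hf, hf'⟩ := hys _ (hbi γ)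
    have hy : ycoord (((A γ)⁻¹ * B γ : Γ) : G2 p r k) = 0 := by
      rw [Subgroup.coe_mul, Subgroup.coe_inv, ycoord_mul, ycoord_inv]
      have hA : ycoord (A γ : G2 p r k) =
          evalInv k v / evalInv k (T u) * τ (ycoord ((γ : Γ) : G2 p r k)) := ycoord_mk _ _
      have hf₁ : ycoord ((γ : Γ) : G2 p r k) = evalInv k f := hf
      have hB : ycoord (B γ : G2 p r k) = _ := hf'
      rw [hA, hB, hf₁, hτT, neg_add_cancel]
    rw [Subgroup.mem_center_iff]
    intro g
    exact Subtype.ext (commute_of_ycoord_eq_zero hy g).symm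
  refine ⟨Γ', hle, centralQuotient A B hcent, ?_, fun γ => ?_⟩
  · rw [Subgroup.finiteIndex_iff]
    refine Subgroup.index_inf_ne_zero ?_ ?_
    · rw [Subgroup.index_map_subtype]
      exact mul_ne_zero (finiteIndex_biIntegral h₁.2 h₂.2).index_ne_zero
        lam.source_finiteIndex.index_ne_zero
    · change (Γ.comap φ.toMonoidHom).relIndex Γ ≠ 0
      -- Chain of comparisons, with I the integral group: φ⁻¹(Γ) against φ⁻¹(I), then φ⁻¹(I) against
      -- I, then I against Γ.
      exact Subgroup.relIndex_ne_zero_trans (Subgroup.relIndex_comap_ne_zero _ hΓ'.1)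
        (Subgroup.relIndex_ne_zero_trans (relIndex_comap_phi_ne_zero hτT hu ha) hΓ'.2)
  · change ((B γ : Γ) : G2 p r k) = ((A γ * ((A γ)⁻¹ * B γ) : Γ) : G2 p r k)
    rw [mul_inv_cancel_left]

end UnipotentG2

end

theorem theorem2 (p : ℕ) [Fact p.Prime] (r : ℕ) (hr : 2 < p ^ r)
    (k : Type*) [Field k] [Finite k] [Algebra (ZMod p) k]
    (Γ : Subgroup (UnipotentG2.G2 p r k))
    (hΓ : UnipotentG2.IsArithmetic (UnipotentG2.G2 p r k) Γ)
    (lam : VirtualAut Γ) :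
    ∃ (τ : LaurentSeries k ≃+* LaurentSeries k) (a : LaurentSeries k) (ha : a ≠ 0),
      UnipotentG2.IsStandard p τ a ∧
      ∃ (Γ' : Subgroup Γ) (hle : Γ' ≤ lam.source) (ζ : Γ' →* Subgroup.center Γ),
        Γ'.FiniteIndex ∧
        ∀ γ : Γ',
          (((lam.toMulEquiv ⟨γ.1, hle γ.2⟩ : lam.target) : Γ) : UnipotentG2.G2 p r k) =
            UnipotentG2.phi τ a ha (γ.1 : UnipotentG2.G2 p r k) *
              ((ζ γ : Γ) : UnipotentG2.G2 p r k) :=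
  UnipotentG2.exists_standard_mul_central p r hr k Γ hΓ lam
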